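/- Let $\mathcal H=\ell^2(\mathbb N)$ be the Hilbert space of single-mode pure states, with Fock basis $(|n\rangle)_{n\ge 0}$, creation and annihilation operators $\hat a^\dagger|n\rangle=\sqrt{n+1}\,|n+1\rangle$, $\hat a|n\rangle=\sqrt n\,|n-1\rangle$ (on their natural domains), displacement operators $\hat D(\beta)=e^{\beta\hat a^\dagger-\beta^*\hat a}$ ($\beta\in\mathbb C$) and coherent states $|\alpha\rangle=e^{-|\alpha|^2/2}\sum_{n\ge 0}\frac{\alpha^n}{\sqrt{n!}}|n\rangle$. For $|\psi\rangle=\sum_n\psi_n|n\rangle\in\mathcal H$, the stellar function is the entire function $F_\psi(\alpha)=\sum_{n\ge 0}\psi_n\frac{\alpha^n}{\sqrt{n!}}=e^{|\alpha|^2/2}\langle\alpha^*|\psi\rangle$, the stellar rank is the number of zeros of $F_\psi$ in $\mathbb C$ counted with multiplicity, and the Husimi function is $Q_\psi(\alpha)=\frac1\pi|\langle\alpha|\psi\rangle|^2=\frac{e^{-|\alpha|^2}}{\pi}|F_\psi(\alpha^*)|^2$. Its roots are the complex conjugates of the zeros of $F_\psi$, and are counted with the multiplicity of these. A Gaussian state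 is a unit vector whose Husimi function is Gaussian, i.e. the exponential of a real quadratic polynomial in $(\operatorname{Re}\alpha,\operatorname{Im}\alpha)$ with negative definite quadratic part. Theorem. Let $|\psi\rangle\in\mathcal H$ be a unit vector of finite stellar rank $r$. Then $Q_\psi$ has exactly $r$ roots counted with multiplicity, and, if $\beta_1,\dots,\beta_r$ are these roots (listed with multiplicity, in any order), there are a Gaussian state $|G_\psi\rangle$, in the domain of the operator below, and a normalisation constant $\mathcal N>0$ with $$|\psi\rangle=\frac1{\mathcal N}\left[\prod_{n=1}^{r}\hat D(\beta_n)\,\hat a^\dagger\,\hat D^\dagger(\beta_n)\right]|G_\psi\rangle .$$ Moreover, this decomposition is unique up to reordering of the roots and a global phase: if $|\psi\rangle$ is also given by this formula with $\gamma_1,\dots,\gamma_s\in\mathbb C$, a Gaussian state $|G'\rangle$ and a constant $\mathcal N'\in\mathbb C\setminus\{0\}$ in place of $\beta_1,\dots,\beta_r$, $|G_\psi\rangle$ and $\mathcal N$, then $s=r$, $(\gamma_n)$ is a permutation of $(\beta_n)$, and there is $u\in\mathbb C$ with $|u|=1$ such that $|G'\rangle=u|G_\psi\rangle$ and $\mathcal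 N'=u\,\mathcal N$. -/

import Mathlib

open scoped ComplexConjugate

namespace Stellar

noncomputable section

/-- The Hilbert space of single-mode pure states, realised as `ℓ²(ℕ, ℂ)`: the `n`-th coordinate
is the coefficient on the Fock state `|n⟩`. -/
abbrev ModeSpace : Type := lp (fun _ : ℕ => ℂ) 2

/-- The Fock (number) state `|n⟩`. -/
def fock (n : ℕ) : ModeSpace := lp.single 2 n (1 : ℂ)

/-! ### Creation and annihilation operators -/

/-- `a† ∑ fₙ |n⟩ = ∑ fₙ √(n+1) |n+1⟩` on coefficient sequences: the coefficient of index `n` of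
the image is `√n f (n-1)`, which is `0` for `n = 0`. -/
def creationSeq : (ℕ → ℂ) →ₗ[ℂ] (ℕ → ℂ) where
  toFun f n := (Real.sqrt n : ℂ) * f (n - 1)
  map_add' f g := by ext n; simp [mul_add]
  map_smul' c f := by ext n; simp; ring

/-- `a ∑ fₙ |n⟩ = ∑ fₙ √n |n-1⟩` on coefficient sequences. -/
def annihilationSeq : (ℕ → ℂ) →ₗ[ℂ] (ℕ → ℂ) where
  toFun f n := (Real.sqrt (n + 1) : ℂ) * f (n + 1)
  map_add' f g := by ext n; simp [mul_add]
  map_smul' c f := by ext n; simp; ring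

/-- The (unbounded) operator on `ℓ²` induced by an operator on sequences, on its maximal domain:
the vectors whose image is again square-summable. -/
def maximalOperator (T : (ℕ → ℂ) →ₗ[ℂ] (ℕ → ℂ)) : ModeSpace →ₗ.[ℂ] ModeSpace where
  domain :=
    { carrier := {ψ | Memℓp (T (fun n => ψ n)) 2}
      add_mem' := by
        intro ψ φ hψ hφ
        have h : T (fun n => (ψ + φ) n) = T (fun n => ψ n) + T (fun n => φ n) := by
          rw [← map_add]; rfl
        simp only [Set.mem_ofPred_eq] at *
        rw [h]; exact hψ.add hφ
      zero_mem' := by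
        have h : T (fun n => (0 : ModeSpace) n) = 0 := map_zero T
        simp only [Set.mem_ofPred_eq]
        rw [h]; exact zero_memℓp
      smul_mem' := by
        intro c ψ hψ
        have h : T (fun n => (c • ψ) n) = c • T (fun n => ψ n) := by
          rw [← map_smul]; rfl
        simp only [Set.mem_ofPred_eq] at *
        rw [h]; exact hψ.const_smul c }
  toFun :=
    { toFun := fun ψ => ⟨T (fun n => (ψ : ModeSpace) n), ψ.2⟩
      map_add' := by
        intro ψ φ
        apply Subtype.ext
        exact map_add T (fun n => (ψ : ModeSpace) n) (fun n => (φ : ModeSpace) n)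
      map_smul' := by
        intro c ψ
        apply Subtype.ext
        exact map_smul T c (fun n => (ψ : ModeSpace) n) }

/-- The creation operator `a†`, with its natural domain `{ψ | ∑ (n+1) |ψₙ|² < ∞}`. -/
def creation : ModeSpace →ₗ.[ℂ] ModeSpace := maximalOperator creationSeq

/-- The annihilation operator `a`, with its natural domain `{ψ | ∑ n |ψₙ|² < ∞}`. -/
def annihilation : ModeSpace →ₗ.[ℂ] ModeSpace := maximalOperator annihilationSeq

/-- Composition `f ∘ g` of unbounded operators, on its natural domain
`{x ∈ dom g | g x ∈ dom f}`. -/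
def pcomp (f g : ModeSpace →ₗ.[ℂ] ModeSpace) : ModeSpace →ₗ.[ℂ] ModeSpace where
  domain := (f.domain.comap g.toFun).map g.domain.subtype
  toFun :=
    { toFun := fun x =>
        f ⟨g ⟨x, by obtain ⟨y, -, hy⟩ := x.2; rw [← hy]; exact y.2⟩, by
          obtain ⟨x, y, hy, rfl⟩ := x; exact hy⟩
      map_add' := by
        intro x y
        rw [← f.map_add]; congr 1; apply Subtype.ext
        exact g.map_add ⟨x, by obtain ⟨z, -, hz⟩ := x.2; rw [← hz]; exact z.2⟩
          ⟨y, by obtain ⟨z, -, hz⟩ := y.2; rw [← hz]; exact z.2⟩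
      map_smul' := by
        intro c x
        rw [RingHom.id_apply, ← f.map_smul]; congr 1; apply Subtype.ext
        exact g.map_smul c ⟨x, by obtain ⟨z, -, hz⟩ := x.2; rw [← hz]; exact z.2⟩ }

/-- A unitary operator seen as an everywhere defined operator. -/
def ofUnitary (U : ModeSpace ≃ₗᵢ[ℂ] ModeSpace) : ModeSpace →ₗ.[ℂ] ModeSpace :=
  (U.toLinearEquiv : ModeSpace →ₗ[ℂ] ModeSpace).toPMap ⊤

/-! ### Displacement operators -/

/-- The exponential series of the unbounded operator `A` at `x` converges to `y`:
all the iterates `Aᵏ x` are defined and `∑ Aᵏ x / k! = y`. -/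
def HasExpSeries (A : ModeSpace →ₗ.[ℂ] ModeSpace) (x y : ModeSpace) : Prop :=
  ∃ v : ℕ → ModeSpace, v 0 = x ∧ (∀ k, ∃ h : v k ∈ A.domain, A ⟨v k, h⟩ = v (k + 1)) ∧
    HasSum (fun k => ((k.factorial : ℂ))⁻¹ • v k) y

/-- The generator `β a† - β* a` of the displacement of amplitude `β`. -/
def displacementGenerator (β : ℂ) : ModeSpace →ₗ.[ℂ] ModeSpace :=
  β • creation - conj β • annihilation

/-- Finite superpositions of Fock states (used to construct the displacement operators). -/
def ofFinsupp : (ℕ →₀ ℂ) →ₗ[ℂ] ModeSpace := Finsupp.linearCombination ℂ fock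

/-- `a†` on finite superpositions of Fock states. -/
def creationFin : (ℕ →₀ ℂ) →ₗ[ℂ] (ℕ →₀ ℂ) :=
  Finsupp.linearCombination ℂ fun n => Finsupp.single (n + 1) (Real.sqrt (n + 1) : ℂ)

/-- `a` on finite superpositions of Fock states. -/
def annihilationFin : (ℕ →₀ ℂ) →ₗ[ℂ] (ℕ →₀ ℂ) :=
  Finsupp.linearCombination ℂ fun n => Finsupp.single (n - 1) (Real.sqrt n : ℂ)

/-- `β a† - β* a` on finite superpositions of Fock states. -/
def generatorFin (β : ℂ) : (ℕ →₀ ℂ) →ₗ[ℂ] (ℕ →₀ ℂ) :=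
  β • creationFin - conj β • annihilationFin

lemma ofFinsupp_single (n : ℕ) (c : ℂ) : ofFinsupp (Finsupp.single n c) = c • fock n := by
  simp [ofFinsupp]

lemma fock_apply (n m : ℕ) : fock n m = if m = n then 1 else 0 := by
  simp [fock, lp.single_apply, Pi.single_apply]

lemma inner_fock_fock (m n : ℕ) : inner ℂ (fock m) (fock n) = if m = n then (1 : ℂ) else 0 := by
  rw [fock, lp.inner_single_left, fock_apply]; simp

lemma creationSeq_ofFinsupp (f : ℕ →₀ ℂ) :
    creationSeq (fun n => ofFinsupp f n) = fun n => ofFinsupp (creationFin f) n := by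
  induction f using Finsupp.induction_linear with
  | zero => ext n; simp [creationSeq]
  | add f g hf hg =>
    have h : (fun n => ofFinsupp (f + g) n) =
        (fun n => ofFinsupp f n) + fun n => ofFinsupp g n := by
      ext n; simp
    rw [h, map_add, hf, hg]; ext n; simp
  | single m c =>
    ext n
    simp only [creationSeq, creationFin, ofFinsupp_single, Finsupp.linearCombination_single,
      Finsupp.smul_single, LinearMap.coe_mk, AddHom.coe_mk, lp.coeFn_smul, Pi.smul_apply,
      fock_apply, smul_eq_mul]
    rcases n with _ | n
    · simp
    · by_cases h : n = m
      · subst h; simp; ring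
      · simp [h]

lemma annihilationSeq_ofFinsupp (f : ℕ →₀ ℂ) :
    annihilationSeq (fun n => ofFinsupp f n) = fun n => ofFinsupp (annihilationFin f) n := by
  induction f using Finsupp.induction_linear with
  | zero => ext n; simp [annihilationSeq]
  | add f g hf hg =>
    have h : (fun n => ofFinsupp (f + g) n) =
        (fun n => ofFinsupp f n) + fun n => ofFinsupp g n := by
      ext n; simp
    rw [h, map_add, hf, hg]; ext n; simp
  | single m c =>
    ext n
    simp only [annihilationSeq, annihilationFin, ofFinsupp_single,
      Finsupp.linearCombination_single,
      Finsupp.smul_single, LinearMap.coe_mk, AddHom.coe_mk, lp.coeFn_smul, Pi.smul_apply,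
      fock_apply, smul_eq_mul]
    rcases m with _ | m
    · simp
    · by_cases h : n = m
      · subst h; simp; ring
      · simp [h]

lemma generator_ofFinsupp (β : ℂ) (f : ℕ →₀ ℂ) :
    ∃ h : ofFinsupp f ∈ (displacementGenerator β).domain,
      displacementGenerator β ⟨ofFinsupp f, h⟩ = ofFinsupp (generatorFin β f) := by
  have h1 : ofFinsupp f ∈ creation.domain := by
    change Memℓp (creationSeq (fun n => ofFinsupp f n)) 2
    rw [creationSeq_ofFinsupp]; exact lp.memℓp _
  have h2 : ofFinsupp f ∈ annihilation.domain := by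
    change Memℓp (annihilationSeq (fun n => ofFinsupp f n)) 2
    rw [annihilationSeq_ofFinsupp]; exact lp.memℓp _
  have e1 : creation ⟨ofFinsupp f, h1⟩ = ofFinsupp (creationFin f) :=
    Subtype.ext (creationSeq_ofFinsupp f)
  have e2 : annihilation ⟨ofFinsupp f, h2⟩ = ofFinsupp (annihilationFin f) :=
    Subtype.ext (annihilationSeq_ofFinsupp f)
  refine ⟨⟨h1, h2⟩, ?_⟩
  have : displacementGenerator β ⟨ofFinsupp f, ⟨h1, h2⟩⟩ =
      β • creation ⟨ofFinsupp f, h1⟩ - conj β • annihilation ⟨ofFinsupp f, h2⟩ := rfl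
  rw [this, e1, e2]
  simp [generatorFin]

lemma generatorFin_single (β : ℂ) (n : ℕ) :
    generatorFin β (Finsupp.single n 1) =
      (β * Real.sqrt (n + 1)) • Finsupp.single (n + 1) 1
        - (conj β * Real.sqrt n) • Finsupp.single (n - 1) 1 := by
  simp [generatorFin, creationFin, annihilationFin]

lemma generatorFin_neg (β : ℂ) : generatorFin (-β) = -generatorFin β := by
  simp only [generatorFin, map_neg]; module

lemma generatorFin_skew (β : ℂ) (f g : ℕ →₀ ℂ) :
    inner ℂ (ofFinsupp (generatorFin β f)) (ofFinsupp g) =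
      -inner ℂ (ofFinsupp f) (ofFinsupp (generatorFin β g)) := by
  induction f using Finsupp.induction_linear with
  | zero => simp
  | add f f' hf hf' => simp only [map_add, inner_add_left, hf, hf']; ring
  | single m c =>
    induction g using Finsupp.induction_linear with
    | zero => simp
    | add g g' hg hg' => simp only [map_add, inner_add_right, hg, hg']; ring
    | single n d =>
      have hm : Finsupp.single m c = c • Finsupp.single m (1 : ℂ) := by simp
      have hn : Finsupp.single n d = d • Finsupp.single n (1 : ℂ) := by simp
      have key : inner ℂ (ofFinsupp (generatorFin β (Finsupp.single m 1)))
          (ofFinsupp (Finsupp.single n 1)) =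
          -inner ℂ (ofFinsupp (Finsupp.single m 1))
            (ofFinsupp (generatorFin β (Finsupp.single n 1))) := by
        simp only [generatorFin_single, map_sub, map_smul, ofFinsupp_single, one_smul,
          inner_smul_left, inner_smul_right, inner_sub_left, inner_sub_right, inner_fock_fock,
          map_mul, Complex.conj_ofReal, Complex.conj_conj]
        rcases m with _ | m <;> rcases n with _ | n
        · simp
        · by_cases h : n = 0
          · subst h; simp
          · simp [h, Ne.symm h]
        · by_cases h : m = 0
          · subst h; simp
          · simp [h]
        · by_cases h1 : m + 1 = n
          · subst h1
            simp [show ¬ (m = m + 1 + 1) by omega]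
          · by_cases h2 : m = n + 1
            · subst h2; simp [show ¬ (n + 1 + 1 = n) by omega]
            · simp [h1, h2]
      rw [hm, hn]
      simp only [map_smul, inner_smul_left, inner_smul_right, key]
      ring

lemma generatorFin_pow_skew (β : ℂ) (k : ℕ) (f g : ℕ →₀ ℂ) :
    inner ℂ (ofFinsupp ((generatorFin β ^ k) f)) (ofFinsupp g) =
      (-1) ^ k * inner ℂ (ofFinsupp f) (ofFinsupp ((generatorFin β ^ k) g)) := by
  induction k generalizing f with
  | zero => simp
  | succ k ih =>
    rw [pow_succ, Module.End.mul_apply, ih, generatorFin_skew, ← Module.End.mul_apply,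
      ← pow_succ']
    rw [pow_succ]; ring

lemma norm_generatorFin_pow_le (β : ℂ) (k n : ℕ) :
    ‖ofFinsupp ((generatorFin β ^ k) (Finsupp.single n 1))‖ ≤
      (2 * ‖β‖) ^ k * Real.sqrt ((n + 1).ascFactorial k) := by
  induction k generalizing n with
  | zero => simp [ofFinsupp_single, fock, lp.norm_single]
  | succ k ih =>
    rw [pow_succ, Module.End.mul_apply, generatorFin_single, map_sub, map_smul, map_smul,
      map_sub, map_smul, map_smul]
    refine (norm_sub_le _ _).trans ?_
    rw [norm_smul, norm_smul, norm_mul, norm_mul, RCLike.norm_conj, Complex.norm_real,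
      Complex.norm_real, Real.norm_of_nonneg (Real.sqrt_nonneg _),
      Real.norm_of_nonneg (Real.sqrt_nonneg _)]
    have hk : 0 ≤ ‖β‖ * (2 * ‖β‖) ^ k := by positivity
    have e1 : Real.sqrt (n + 1) * Real.sqrt ((n + 1 + 1).ascFactorial k) ≤
        Real.sqrt ((n + 1).ascFactorial (k + 1)) := by
      rw [← Real.sqrt_mul (by positivity)]
      apply Real.sqrt_le_sqrt
      exact_mod_cast (Nat.succ_ascFactorial (n + 1) k).le
    have e2 : Real.sqrt n * Real.sqrt ((n - 1 + 1).ascFactorial k) ≤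
        Real.sqrt ((n + 1).ascFactorial (k + 1)) := by
      rw [← Real.sqrt_mul (by positivity)]
      apply Real.sqrt_le_sqrt
      have : n * (n - 1 + 1).ascFactorial k ≤ (n + 1).ascFactorial (k + 1) := by
        rcases n with _ | n
        · simp
        · have h := Nat.succ_ascFactorial (n + 1) k
          have h' : (n + 1).ascFactorial k ≤ (n + 1 + 1).ascFactorial k := by
            by_contra hlt
            push Not at hlt
            nlinarith
          rw [Nat.ascFactorial_succ]
          exact Nat.mul_le_mul (by omega) h'
      exact_mod_cast this
    have t1 : ‖β‖ * Real.sqrt (n + 1) *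
        ‖ofFinsupp ((generatorFin β ^ k) (Finsupp.single (n + 1) 1))‖ ≤
        ‖β‖ * (2 * ‖β‖) ^ k * Real.sqrt ((n + 1).ascFactorial (k + 1)) := by
      calc _ ≤ ‖β‖ * Real.sqrt (n + 1) *
            ((2 * ‖β‖) ^ k * Real.sqrt ((n + 1 + 1).ascFactorial k)) := by
              gcongr; exact ih (n + 1)
        _ = ‖β‖ * (2 * ‖β‖) ^ k *
            (Real.sqrt (n + 1) * Real.sqrt ((n + 1 + 1).ascFactorial k)) := by ring
        _ ≤ _ := mul_le_mul_of_nonneg_left e1 hk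
    have t2 : ‖β‖ * Real.sqrt n *
        ‖ofFinsupp ((generatorFin β ^ k) (Finsupp.single (n - 1) 1))‖ ≤
        ‖β‖ * (2 * ‖β‖) ^ k * Real.sqrt ((n + 1).ascFactorial (k + 1)) := by
      calc _ ≤ ‖β‖ * Real.sqrt n *
            ((2 * ‖β‖) ^ k * Real.sqrt ((n - 1 + 1).ascFactorial k)) := by
              gcongr; exact ih (n - 1)
        _ = ‖β‖ * (2 * ‖β‖) ^ k *
            (Real.sqrt n * Real.sqrt ((n - 1 + 1).ascFactorial k)) := by ring
        _ ≤ _ := mul_le_mul_of_nonneg_left e2 hk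
    calc _ ≤ _ := add_le_add t1 t2
      _ = _ := by ring

lemma summable_generatorFin_pow (β : ℂ) (f : ℕ →₀ ℂ) :
    Summable fun k => ‖((k.factorial : ℂ))⁻¹ • ofFinsupp ((generatorFin β ^ k) f)‖ := by
  induction f using Finsupp.induction_linear with
  | zero => simp
  | add f g hf hg =>
    refine Summable.of_nonneg_of_le (fun _ => norm_nonneg _) (fun k => ?_) (hf.add hg)
    rw [map_add, map_add, smul_add]; exact norm_add_le _ _
  | single n c =>
    have hs : Summable fun k => ‖c‖ *
        ((2 : ℝ) ^ n * ((16 * ‖β‖ ^ 2) ^ k / (k.factorial : ℝ)) + (1 / 2) ^ k) :=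
      (((Real.summable_pow_div_factorial _).mul_left _).add
        (summable_geometric_of_lt_one (by norm_num) (by norm_num))).mul_left _
    refine Summable.of_nonneg_of_le (fun _ => norm_nonneg _) (fun k => ?_) hs
    have hc : Finsupp.single n c = c • Finsupp.single n (1 : ℂ) := by simp
    rw [hc, map_smul, map_smul, smul_comm, norm_smul, norm_smul]
    refine mul_le_mul_of_nonneg_left ?_ (norm_nonneg _)
    have hk : (0 : ℝ) < (k.factorial : ℝ) := by exact_mod_cast k.factorial_pos
    rw [norm_inv, Complex.norm_natCast]
    refine (mul_le_mul_of_nonneg_left (norm_generatorFin_pow_le β k n)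
      (inv_nonneg.2 hk.le)).trans ?_
    have ha : (((n + 1).ascFactorial k : ℕ) : ℝ) ≤ (k.factorial : ℝ) * 2 ^ (n + k) := by
      rw [Nat.ascFactorial_eq_factorial_mul_choose]
      exact_mod_cast Nat.mul_le_mul_left _ (Nat.choose_le_two_pow _ _)
    have hsq : Real.sqrt ((n + 1).ascFactorial k) ^ 2 = ((n + 1).ascFactorial k : ℕ) :=
      Real.sq_sqrt (by positivity)
    set s := Real.sqrt ((n + 1).ascFactorial k)
    have hs0 : 0 ≤ s := Real.sqrt_nonneg _
    set X := (k.factorial : ℝ)⁻¹ * ((2 * ‖β‖) ^ k * s) with hX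
    have hX2 : X ^ 2 ≤ (2 : ℝ) ^ n * ((16 * ‖β‖ ^ 2) ^ k / (k.factorial : ℝ)) * (1 / 2) ^ k := by
      have : X ^ 2 = ((2 * ‖β‖) ^ k) ^ 2 * s ^ 2 / (k.factorial : ℝ) ^ 2 := by
        rw [hX]; field_simp
      rw [this, hsq]
      have h16 : (2 : ℝ) ^ n * ((16 * ‖β‖ ^ 2) ^ k / (k.factorial : ℝ)) * (1 / 2) ^ k =
          ((2 * ‖β‖) ^ k) ^ 2 * ((k.factorial : ℝ) * 2 ^ (n + k)) / (k.factorial : ℝ) ^ 2 := by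
        have h4 : (16 * ‖β‖ ^ 2) ^ k = ((2 * ‖β‖) ^ k) ^ 2 * 2 ^ k * 2 ^ k := by
          rw [← pow_mul, mul_comm k 2, pow_mul, ← mul_pow, ← mul_pow]; congr 1; ring
        rw [h4, pow_add, one_div, inv_pow]
        field_simp
      rw [h16]
      gcongr
    have hP : 0 ≤ (2 : ℝ) ^ n * ((16 * ‖β‖ ^ 2) ^ k / (k.factorial : ℝ)) := by positivity
    have hQ : (0 : ℝ) ≤ (1 / 2) ^ k := by positivity
    nlinarith [sq_nonneg ((2 : ℝ) ^ n * ((16 * ‖β‖ ^ 2) ^ k / (k.factorial : ℝ)) - (1 / 2) ^ k)]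

/-- The terms `Aᵏ f / k!` of the exponential series of `A = β a† - β* a` on a finite
superposition `f` of Fock states. -/
def expTerm (β : ℂ) (f : ℕ →₀ ℂ) (k : ℕ) : ModeSpace :=
  ((k.factorial : ℂ))⁻¹ • ofFinsupp ((generatorFin β ^ k) f)

lemma hasSum_expTerm (β : ℂ) (f : ℕ →₀ ℂ) : HasSum (expTerm β f) (∑' k, expTerm β f k) :=
  (summable_generatorFin_pow β f).of_norm.hasSum

lemma hasExpSeries_ofFinsupp (β : ℂ) (f : ℕ →₀ ℂ) :
    HasExpSeries (displacementGenerator β) (ofFinsupp f) (∑' k, expTerm β f k) := by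
  refine ⟨fun k => ofFinsupp ((generatorFin β ^ k) f), by simp, fun k => ?_, hasSum_expTerm β f⟩
  obtain ⟨h, e⟩ := generator_ofFinsupp β ((generatorFin β ^ k) f)
  refine ⟨h, e.trans ?_⟩
  simp only [pow_succ', Module.End.mul_apply]

lemma HasExpSeries.unique {A : ModeSpace →ₗ.[ℂ] ModeSpace} {x y z : ModeSpace}
    (hy : HasExpSeries A x y) (hz : HasExpSeries A x z) : y = z := by
  obtain ⟨v, hv0, hv, hvs⟩ := hy
  obtain ⟨w, hw0, hw, hws⟩ := hz
  have : v = w := by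
    funext k
    induction k with
    | zero => rw [hv0, hw0]
    | succ k ih =>
      obtain ⟨h1, e1⟩ := hv k
      obtain ⟨h2, e2⟩ := hw k
      rw [← e1, ← e2]
      congr 1
      exact Subtype.ext ih
  subst this
  exact hvs.unique hws

lemma inner_expTerm_ofFinsupp (β : ℂ) (f g : ℕ →₀ ℂ) (k : ℕ) :
    inner ℂ (expTerm β f k) (ofFinsupp g) = inner ℂ (ofFinsupp f) (expTerm (-β) g k) := by
  have h : (generatorFin (-β) ^ k) g = ((-1 : ℂ) ^ k) • (generatorFin β ^ k) g := by
    have e : generatorFin (-β) = (-1 : ℂ) • generatorFin β := by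
      rw [generatorFin_neg]; module
    rw [e, smul_pow, LinearMap.smul_apply]
  rw [expTerm, expTerm, inner_smul_left, inner_smul_right, generatorFin_pow_skew, h, map_smul,
    inner_smul_right]
  simp

lemma inner_exp_ofFinsupp (β : ℂ) (f g : ℕ →₀ ℂ) :
    inner ℂ (∑' k, expTerm β f k) (ofFinsupp g) =
      inner ℂ (ofFinsupp f) (∑' k, expTerm (-β) g k) := by
  have h1 := (innerSLFlip ℂ (ofFinsupp g)).hasSum (hasSum_expTerm β f)
  have h2 := (innerSL ℂ (ofFinsupp f)).hasSum (hasSum_expTerm (-β) g)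
  refine h1.unique ((congrArg (HasSum · _) (funext fun k => ?_)).mpr h2)
  exact inner_expTerm_ofFinsupp β f g k

lemma inner_exp_exp (β : ℂ) (f g : ℕ →₀ ℂ) :
    inner ℂ (∑' k, expTerm β f k) (∑' k, expTerm β g k) =
      inner ℂ (ofFinsupp f) (ofFinsupp g) := by
  have hf := summable_generatorFin_pow β f
  have hg := summable_generatorFin_pow β g
  have hprod : Summable fun p : ℕ × ℕ => inner ℂ (expTerm β f p.1) (expTerm β g p.2) := by
    refine Summable.of_norm_bounded (hf.mul_of_nonneg hg (fun _ => norm_nonneg _)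
      (fun _ => norm_nonneg _)) (fun p => norm_inner_le_norm _ _)
  have e1 : inner ℂ (∑' k, expTerm β f k) (∑' k, expTerm β g k) =
      ∑' p : ℕ × ℕ, inner ℂ (expTerm β f p.1) (expTerm β g p.2) := by
    rw [hprod.tsum_prod]
    have h2 : ∀ x, inner ℂ x (∑' k, expTerm β g k) = ∑' k, inner ℂ x (expTerm β g k) :=
      fun x => (((innerSL ℂ x).hasSum (hasSum_expTerm β g)).tsum_eq).symm
    have h3 := ((innerSLFlip ℂ (∑' k, expTerm β g k)).hasSum (hasSum_expTerm β f)).tsum_eq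
    simp only [innerSLFlip_apply_apply] at h3
    rw [← h3]
    exact tsum_congr fun k => h2 _
  rw [e1, ← Finset.HasAntidiagonal.sigmaAntidiagonalEquivProd.tsum_eq,
    Summable.tsum_sigma'
      (f := fun c : (n : ℕ) × Finset.HasAntidiagonal.antidiagonal n =>
        (inner ℂ (expTerm β f (Finset.HasAntidiagonal.sigmaAntidiagonalEquivProd c).1)
          (expTerm β g (Finset.HasAntidiagonal.sigmaAntidiagonalEquivProd c).2) : ℂ))
      (fun n => (hasSum_fintype _).summable)
      (Finset.HasAntidiagonal.sigmaAntidiagonalEquivProd.summable_iff.2 hprod)]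
  have hterm : ∀ n : ℕ, ∑' c : Finset.HasAntidiagonal.antidiagonal n,
      inner ℂ (expTerm β f (Finset.HasAntidiagonal.sigmaAntidiagonalEquivProd ⟨n, c⟩).1)
        (expTerm β g (Finset.HasAntidiagonal.sigmaAntidiagonalEquivProd ⟨n, c⟩).2) =
      if n = 0 then inner ℂ (ofFinsupp f) (ofFinsupp g) else 0 := by
    intro n
    have hc : ∀ c : Finset.HasAntidiagonal.antidiagonal n,
        inner ℂ (expTerm β f (Finset.HasAntidiagonal.sigmaAntidiagonalEquivProd ⟨n, c⟩).1)
          (expTerm β g (Finset.HasAntidiagonal.sigmaAntidiagonalEquivProd ⟨n, c⟩).2) =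
        (fun m : ℕ × ℕ => ((n.factorial : ℂ))⁻¹ * (n.choose m.1 • ((-1 : ℂ) ^ m.1 * 1 ^ m.2)) *
          inner ℂ (ofFinsupp f) (ofFinsupp ((generatorFin β ^ n) g))) c := by
      rintro ⟨⟨i, j⟩, hij⟩
      have hij' : i + j = n := by simpa using hij
      subst hij'
      simp only [Finset.HasAntidiagonal.sigmaAntidiagonalEquivProd_apply, expTerm,
        inner_smul_left, inner_smul_right, generatorFin_pow_skew, ← Module.End.mul_apply,
        ← pow_add, map_inv₀, map_natCast, nsmul_eq_mul, one_pow, mul_one]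
      have h := Nat.add_choose_mul_factorial_mul_factorial i j
      rw [Nat.choose_symm_add]
      have h' : (((i + j).choose j : ℕ) : ℂ) * i.factorial * j.factorial = (i + j).factorial := by
        exact_mod_cast h
      have hi : (i.factorial : ℂ) ≠ 0 := by exact_mod_cast i.factorial_ne_zero
      have hj : (j.factorial : ℂ) ≠ 0 := by exact_mod_cast j.factorial_ne_zero
      have hn : ((i + j).factorial : ℂ) ≠ 0 := by exact_mod_cast (i + j).factorial_ne_zero
      field_simp
      rw [← h']
      ring
    rw [tsum_congr hc, Finset.tsum_subtype (Finset.HasAntidiagonal.antidiagonal n)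
      (fun m : ℕ × ℕ => ((n.factorial : ℂ))⁻¹ * (n.choose m.1 • ((-1 : ℂ) ^ m.1 * 1 ^ m.2)) *
          inner ℂ (ofFinsupp f) (ofFinsupp ((generatorFin β ^ n) g))),
      ← Finset.sum_mul, ← Finset.mul_sum,
      ← (Commute.all (-1 : ℂ) 1).add_pow' n]
    by_cases hn : n = 0
    · subst hn; simp
    · simp [hn]
  rw [tsum_congr hterm, tsum_ite_eq]

/-- Existence and uniqueness of the displacement operators: there is exactly one unitary operator
whose value at every Fock state is the sum of the exponential series of `β a† - β* a`. -/
theorem existsUnique_displacement (β : ℂ) : ∃! U : ModeSpace ≃ₗᵢ[ℂ] ModeSpace,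
    ∀ n, HasExpSeries (displacementGenerator β) (fock n) (U (fock n)) := by
  have hfs : ∀ n, ofFinsupp (Finsupp.single n 1) = fock n := fun n => by
    simp [ofFinsupp_single]
  set d : ℂ → ℕ → ModeSpace := fun γ n => ∑' k, expTerm γ (Finsupp.single n 1) k with hd
  have hd1 : ∀ γ, Orthonormal ℂ (d γ) := by
    intro γ
    rw [orthonormal_iff_ite]
    intro i j
    rw [hd]
    simp only
    rw [inner_exp_exp, hfs, hfs, inner_fock_fock]
  have hdexp : ∀ n, HasExpSeries (displacementGenerator β) (fock n) (d β n) := fun n => by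
    have := hasExpSeries_ofFinsupp β (Finsupp.single n 1)
    rwa [hfs] at this
  have hadj : ∀ m n, inner ℂ (d β m) (fock n) = inner ℂ (fock m) (d (-β) n) := fun m n => by
    have := inner_exp_ofFinsupp β (Finsupp.single m 1) (Finsupp.single n 1)
    rwa [hfs, hfs] at this
  have hsum : ∀ x : ModeSpace, HasSum (fun n => x n • fock n) x := by
    intro x
    have := lp.hasSum_single (E := fun _ : ℕ => ℂ) (p := 2) (by simp) x
    convert this using 2 with n
    ext m
    simp [fock, lp.single_apply, Pi.single_apply]
  set T := (hd1 (-β)).orthogonalFamily.linearIsometry with hT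
  have hT1 : ∀ n, T (fock n) = d (-β) n := by
    intro n
    rw [hT, fock, OrthogonalFamily.linearIsometry_apply_single]
    simp
  have hTadj : ∀ m x, inner ℂ (d β m) x = inner ℂ (fock m) (T x) := by
    intro m x
    have h1 := (innerSL ℂ (d β m)).hasSum (hsum x)
    have h2 := (innerSL ℂ (fock m)).hasSum (T.toContinuousLinearMap.hasSum (hsum x))
    refine h1.unique ?_
    refine (congrArg (HasSum · _) (funext fun n => ?_)).mpr h2
    simp only [map_smul, LinearIsometry.coe_toContinuousLinearMap, hT1,
      innerSL_apply_apply, hadj]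
  have hbot : (Submodule.span ℂ (Set.range (d β)))ᗮ = ⊥ := by
    rw [Submodule.eq_bot_iff]
    intro x hx
    have hx' : ∀ m, inner ℂ (d β m) x = 0 := fun m =>
      (Submodule.mem_orthogonal _ _).1 hx _ (Submodule.subset_span ⟨m, rfl⟩)
    have hTx : T x = 0 := by
      ext m
      have := hx' m
      rw [hTadj, fock, lp.inner_single_left] at this
      simpa using this
    exact T.injective (by rw [hTx, map_zero])
  let b := HilbertBasis.mkOfOrthogonalEqBot (hd1 β) hbot
  have hb : ∀ n, b.repr.symm (fock n) = d β n := fun n => by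
    rw [fock, HilbertBasis.repr_symm_single, HilbertBasis.coe_mkOfOrthogonalEqBot]
  refine ⟨b.repr.symm, fun n => ?_, fun V hV => ?_⟩
  · simp only [hb]; exact hdexp n
  · have hV' : ∀ n, V (fock n) = b.repr.symm (fock n) := fun n => by
      rw [hb]; exact (hV n).unique (hdexp n)
    ext1 x
    have h1 := V.toContinuousLinearEquiv.toContinuousLinearMap.hasSum (hsum x)
    have h2 := b.repr.symm.toContinuousLinearEquiv.toContinuousLinearMap.hasSum (hsum x)
    refine h1.unique ?_
    refine (congrArg (HasSum · _) (funext fun n => ?_)).mpr h2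
    simp [hV']

/-- The displacement operator `D(β) = exp(β a† - β* a)`: the unitary operator given at every Fock
state by the exponential series of `β a† - β* a`. -/
def displacement (β : ℂ) : ModeSpace ≃ₗᵢ[ℂ] ModeSpace :=
  (existsUnique_displacement β).choose

/-- `D(β) a† D†(β)`, on its natural domain; the inverse of the unitary operator `D(β)` is its
adjoint. -/
def displacedCreation (β : ℂ) : ModeSpace →ₗ.[ℂ] ModeSpace :=
  pcomp (ofUnitary (displacement β)) (pcomp creation (ofUnitary (displacement β).symm))

/-- The product `D(β₁) a† D†(β₁) ⋯ D(βᵣ) a† D†(βᵣ)`, on its natural domain (the identity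
operator if `r = 0`). -/
def displacedCreationProd {r : ℕ} (β : Fin r → ℂ) : ModeSpace →ₗ.[ℂ] ModeSpace :=
  (List.ofFn fun n => displacedCreation (β n)).foldr pcomp
    (ofUnitary (LinearIsometryEquiv.refl ℂ ModeSpace))

/-! ### Stellar function, Husimi function, stellar rank, Gaussian states -/

/-- The coherent state `|α⟩ = e^{-|α|²/2} ∑ αⁿ/√(n!) |n⟩`. -/
def coherent (α : ℂ) : ModeSpace :=
  ⟨fun n => (Real.exp (-(‖α‖ ^ 2 / 2)) : ℂ) * (α ^ n / (Real.sqrt n.factorial : ℂ)), by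
    apply memℓp_gen
    have h := (Real.summable_pow_div_factorial (‖α‖ ^ 2)).mul_left
      (Real.exp (-(‖α‖ ^ 2 / 2)) ^ 2)
    refine (summable_congr fun n => ?_).2 h
    rw [norm_mul, norm_div, norm_pow, Complex.norm_real, Complex.norm_real,
      Real.norm_of_nonneg (Real.exp_nonneg _), Real.norm_of_nonneg (Real.sqrt_nonneg _)]
    simp only [ENNReal.toReal_ofNat, Real.rpow_ofNat]
    rw [mul_pow, div_pow, Real.sq_sqrt (by positivity), ← pow_mul, ← pow_mul, mul_comm n 2]⟩

/-- The stellar function `F_ψ(α) = ∑ ψₙ αⁿ/√(n!)`. -/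
def stellarFunction (ψ : ModeSpace) (α : ℂ) : ℂ :=
  ∑' n : ℕ, ψ n * (α ^ n / (Real.sqrt n.factorial : ℂ))

/-- The other expression of the stellar function: `F_ψ(α) = e^{|α|²/2} ⟨α*|ψ⟩`. -/
lemma stellarFunction_eq (ψ : ModeSpace) (α : ℂ) :
    stellarFunction ψ α =
      (Real.exp (‖α‖ ^ 2 / 2) : ℂ) * inner ℂ (coherent (conj α)) ψ := by
  rw [lp.inner_eq_tsum, ← tsum_mul_left, stellarFunction]
  refine tsum_congr fun n => ?_
  have h : (Real.exp (‖α‖ ^ 2 / 2) : ℂ) * (Real.exp (-(‖α‖ ^ 2 / 2)) : ℂ) = 1 := by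
    rw [← Complex.ofReal_mul, ← Real.exp_add]; simp
  simp only [coherent, RCLike.inner_apply, map_mul, map_div₀, map_pow, Complex.conj_conj,
    Complex.conj_ofReal, RCLike.norm_conj]
  linear_combination (-(ψ n) * (α ^ n / (Real.sqrt n.factorial : ℂ))) * h

/-- The Husimi function `Q_ψ(α) = |⟨α|ψ⟩|² / π`. -/
def husimi (ψ : ModeSpace) (α : ℂ) : ℝ :=
  1 / Real.pi * ‖inner ℂ (coherent α) ψ‖ ^ 2

/-- The stellar rank: the number of zeros of the stellar function, counted with multiplicity, in
`ℕ ∪ {∞}`. -/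
def stellarRank (ψ : ModeSpace) : ℕ∞ :=
  ⨆ s : Finset ℂ, ∑ z ∈ s, analyticOrderAt (stellarFunction ψ) z

/-- The multiplicity of `z` as a root of the Husimi function
`Q_ψ(α) = e^{-|α|²} |F_ψ(α*)|² / π`: if `Q_ψ(z) = 0`, it is the order of vanishing of the
holomorphic function `F_ψ` at `z*` (so `Q_ψ` vanishes at `z` like `|α - z|` to the power twice the
multiplicity); it is `0` if `z` is not a root. -/
def husimiMultiplicity (ψ : ModeSpace) (z : ℂ) : ℕ∞ :=
  open Classical in
  if husimi ψ z = 0 then analyticOrderAt (stellarFunction ψ) (conj z) else 0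

/-- `β₁, …, βᵣ` are the roots of the Husimi function of `ψ`, listed with multiplicity. -/
def IsHusimiRoots (ψ : ModeSpace) {r : ℕ} (β : Fin r → ℂ) : Prop :=
  ∀ z : ℂ, husimiMultiplicity ψ z = (Nat.card {n : Fin r // β n = z} : ℕ∞)

/-- A pure Gaussian state: a normalised vector whose Husimi function is Gaussian, that is, the
exponential of a quadratic polynomial in `(Re α, Im α)` with negative definite quadratic part. -/
def IsGaussianState (ψ : ModeSpace) : Prop :=
  ‖ψ‖ = 1 ∧ ∃ (K A B C : ℝ) (μ : ℂ), 0 < K ∧ 0 < A ∧ B ^ 2 < A * C ∧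
    ∀ α : ℂ, husimi ψ α = K * Real.exp (-(A * (α.re - μ.re) ^ 2
      + 2 * B * (α.re - μ.re) * (α.im - μ.im) + C * (α.im - μ.im) ^ 2))

/-- `ψ = (1/𝒩) [∏ₙ D(βₙ) a† D†(βₙ)] G`, where `G` is a Gaussian state (in the domain of the
product) and `𝒩` is a nonzero constant. -/
structure IsStellarDecomposition (ψ : ModeSpace) {r : ℕ} (β : Fin r → ℂ) (G : ModeSpace)
    (𝒩 : ℂ) : Prop where
  gaussian : IsGaussianState G
  const_ne_zero : 𝒩 ≠ 0
  eq_smul : ∃ h : G ∈ (displacedCreationProd β).domain,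
    ψ = 𝒩⁻¹ • displacedCreationProd β ⟨G, h⟩

end

end Stellar

/-!
Everything is read off from stellar functions. A state is determined by its stellar function, and
`a†` acts on stellar functions as multiplication by the variable `α`. The displacement `D(β)` acts,
up to a nonzero constant, as `F(α) ↦ e^{βα} F(α - β*)` (`exists_stellarFunction_displacement`): on
the Fock basis this follows by summing the commutation relations of `β a† - β* a` with `a†` and `a`
over the exponential series, and both sides are continuous in the state. Hence `D(β) a† D†(β)` is
multiplication by `α - β*`, on the largest possible domain (`mem_graph_displacedCreation_iff`), and
the product of these operators multiplies stellar functions by `∏ (α - βₙ*)`.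

A zero of a stellar function at `β*` can be divided out without leaving `ℓ²`
(`exists_mem_graph_displacedCreation`): after a displacement the zero is at the origin, where the
division is the shift `χₙ₊₁ / √(n+1)`. Dividing out all roots leaves a state with zero-free stellar
function `e^h`. Since `|e^{h(α)}| ≤ ‖φ‖ e^{|α|²/2}`, the theorem of Borel–Carathéodory and Cauchy's
estimates make `h` a polynomial `a + bα + cα²`. Moreover `|e^{h(α)}| e^{-|α|²/2} → 0` at infinity,
because coherent states tend weakly to `0`, and this forces `|c| < 1/2`
(`exists_stellarFunction_eq_exp`), which is the negative definiteness needed for a Gaussian Husimi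
function.

For uniqueness, Gaussian states have zero-free stellar functions, so that in any decomposition the
`βₙ` are the roots of the Husimi function with multiplicity; the remaining factor is then determined
because multiplication by a nonzero polynomial is injective on continuous functions.
-/

namespace Stellar

/-! ### Entire power series -/

lemma hasFPowerSeriesOnBall_ofScalars {c : ℕ → ℂ} {f : ℂ → ℂ}
    (h : ∀ z, HasSum (fun n => c n * z ^ n) (f z)) :
    HasFPowerSeriesOnBall f (FormalMultilinearSeries.ofScalars ℂ c) 0 ⊤ where
  r_le := by
    refine ENNReal.le_of_forall_nnreal_lt fun r _ => ?_
    refine FormalMultilinearSeries.le_radius_of_tendsto _ (l := 0) ?_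
    have := (h r).summable.tendsto_atTop_zero.norm
    simpa [FormalMultilinearSeries.ofScalars_norm] using this
  r_pos := by simp
  hasSum := by
    intro y _
    simpa [FormalMultilinearSeries.ofScalars_apply_eq, mul_comm] using h y

lemma coeff_unique {a b : ℕ → ℂ} {f : ℂ → ℂ}
    (ha : ∀ z, HasSum (fun n => a n * z ^ n) (f z))
    (hb : ∀ z, HasSum (fun n => b n * z ^ n) (f z)) : a = b := by
  have h := (hasFPowerSeriesOnBall_ofScalars ha).hasFPowerSeriesAt.eq_formalMultilinearSeries
    (hasFPowerSeriesOnBall_ofScalars hb).hasFPowerSeriesAt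
  funext n
  simpa [FormalMultilinearSeries.coeff_ofScalars] using congrArg (fun p => p.coeff n) h

lemma sqrt_factorial_ne_zero (n : ℕ) : (Real.sqrt n.factorial : ℂ) ≠ 0 := by
  have : (0 : ℝ) < n.factorial := by exact_mod_cast n.factorial_pos
  exact_mod_cast (Real.sqrt_pos.2 this).ne'

lemma sqrt_succ_ne_zero (n : ℕ) : (Real.sqrt (n + 1) : ℂ) ≠ 0 := by
  exact_mod_cast (Real.sqrt_pos.2 (by positivity)).ne'

lemma sqrt_factorial_succ (n : ℕ) :
    (Real.sqrt (n + 1).factorial : ℂ) = Real.sqrt (n + 1) * Real.sqrt n.factorial := by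
  rw [Nat.factorial_succ, ← Complex.ofReal_mul, ← Real.sqrt_mul (by positivity)]
  push_cast
  rfl

/-- The coefficients of an entire function in the basis `αⁿ/√(n!)` are unique. -/
lemma fock_coeff_unique {a b : ℕ → ℂ} {f : ℂ → ℂ}
    (ha : ∀ α, HasSum (fun n => a n * (α ^ n / (Real.sqrt n.factorial : ℂ))) (f α))
    (hb : ∀ α, HasSum (fun n => b n * (α ^ n / (Real.sqrt n.factorial : ℂ))) (f α)) : a = b := by
  have h : (fun n => a n / (Real.sqrt n.factorial : ℂ)) =
      fun n => b n / (Real.sqrt n.factorial : ℂ) :=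
    coeff_unique
      (fun z => (congrArg (HasSum · _) (funext fun n => by ring)).mpr (ha z))
      (fun z => (congrArg (HasSum · _) (funext fun n => by ring)).mpr (hb z))
  funext n
  exact (div_left_inj' (sqrt_factorial_ne_zero n)).1 (congrFun h n)

/-! ### The stellar function -/

lemma hasSum_stellarFunction (ψ : ModeSpace) (α : ℂ) :
    HasSum (fun n => ψ n * (α ^ n / (Real.sqrt n.factorial : ℂ))) (stellarFunction ψ α) := by
  have h := (lp.hasSum_inner (coherent (conj α)) ψ).mul_left (Real.exp (‖α‖ ^ 2 / 2) : ℂ)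
  rw [← stellarFunction_eq] at h
  refine (congrArg (HasSum · _) (funext fun n => ?_)).mpr h
  have h : (Real.exp (‖α‖ ^ 2 / 2) : ℂ) * (Real.exp (-(‖α‖ ^ 2 / 2)) : ℂ) = 1 := by
    rw [← Complex.ofReal_mul, ← Real.exp_add]; simp
  simp only [coherent, RCLike.inner_apply, map_mul, map_div₀, map_pow, Complex.conj_conj,
    Complex.conj_ofReal, RCLike.norm_conj]
  linear_combination (-(ψ n) * (α ^ n / (Real.sqrt n.factorial : ℂ))) * h

lemma differentiable_stellarFunction (ψ : ModeSpace) : Differentiable ℂ (stellarFunction ψ) := by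
  have h := hasFPowerSeriesOnBall_ofScalars (c := fun n => ψ n / (Real.sqrt n.factorial : ℂ))
    (f := stellarFunction ψ)
    (fun z => (congrArg (HasSum · _) (funext fun n => by ring)).mpr (hasSum_stellarFunction ψ z))
  have := h.differentiableOn
  rwa [Metric.eball_top, differentiableOn_univ] at this

lemma analyticAt_stellarFunction (ψ : ModeSpace) (z : ℂ) : AnalyticAt ℂ (stellarFunction ψ) z :=
  (differentiable_stellarFunction ψ).analyticAt z

lemma stellarFunction_injective : Function.Injective stellarFunction := by
  intro φ ψ h
  ext n
  exact congrFun (fock_coeff_unique (hasSum_stellarFunction φ)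
    (fun α => h ▸ hasSum_stellarFunction ψ α)) n

lemma stellarFunction_smul (c : ℂ) (ψ : ModeSpace) (α : ℂ) :
    stellarFunction (c • ψ) α = c * stellarFunction ψ α := by
  rw [stellarFunction_eq, stellarFunction_eq, inner_smul_right]; ring

lemma stellarFunction_add (φ ψ : ModeSpace) (α : ℂ) :
    stellarFunction (φ + ψ) α = stellarFunction φ α + stellarFunction ψ α := by
  rw [stellarFunction_eq, stellarFunction_eq, stellarFunction_eq, inner_add_right]; ring

lemma stellarFunction_zero (α : ℂ) : stellarFunction 0 α = 0 := by
  rw [stellarFunction_eq, inner_zero_right, mul_zero]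

/-- The value of the stellar function at `α`, as a continuous linear functional of the state. -/
noncomputable def stellarFunctional (α : ℂ) : ModeSpace →L[ℂ] ℂ :=
  (Real.exp (‖α‖ ^ 2 / 2) : ℂ) • innerSL ℂ (coherent (conj α))

lemma stellarFunctional_apply (α : ℂ) (ψ : ModeSpace) :
    stellarFunctional α ψ = stellarFunction ψ α := by
  simp [stellarFunctional, stellarFunction_eq]

lemma stellarFunction_fock (n : ℕ) (α : ℂ) :
    stellarFunction (fock n) α = α ^ n / (Real.sqrt n.factorial : ℂ) := by
  rw [stellarFunction, tsum_eq_single n (fun m hm => by simp [fock_apply, hm])]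
  simp [fock_apply]

lemma hasSum_fock (ψ : ModeSpace) : HasSum (fun n => ψ n • fock n) ψ := by
  have := lp.hasSum_single (E := fun _ : ℕ => ℂ) (p := 2) (by simp) ψ
  convert this using 2 with n
  ext m
  simp [fock, lp.single_apply, Pi.single_apply]

/-- Two continuous linear functionals that agree on the Fock basis are equal. -/
lemma clm_ext_fock {S T : ModeSpace →L[ℂ] ℂ} (h : ∀ n, S (fock n) = T (fock n)) : S = T := by
  ext ψ
  refine (S.hasSum (hasSum_fock ψ)).unique ?_
  refine (congrArg (HasSum · _) (funext fun n => ?_)).mpr (T.hasSum (hasSum_fock ψ))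
  simp [h]

lemma norm_coherent (α : ℂ) : ‖coherent α‖ = 1 := by
  have h : ‖coherent α‖ ^ 2 = 1 := by
    have := lp.norm_rpow_eq_tsum (p := 2) (by simp) (coherent α)
    simp only [ENNReal.toReal_ofNat, Real.rpow_ofNat] at this
    rw [this]
    have h2 : ∀ n, ‖coherent α n‖ ^ 2 =
        Real.exp (-‖α‖ ^ 2) * ((‖α‖ ^ 2) ^ n / n.factorial) := by
      intro n
      simp only [coherent]
      rw [norm_mul, norm_div, norm_pow, Complex.norm_real, Complex.norm_real,
        Real.norm_of_nonneg (Real.exp_nonneg _), Real.norm_of_nonneg (Real.sqrt_nonneg _),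
        mul_pow, div_pow, Real.sq_sqrt (by positivity), ← pow_mul, ← pow_mul, mul_comm n 2,
        ← Real.exp_nat_mul]
      congr 2
      push_cast; ring
    have h3 : ∑' n : ℕ, (‖α‖ ^ 2) ^ n / (n.factorial : ℝ) = Real.exp (‖α‖ ^ 2) := by
      rw [Real.exp_eq_exp_ℝ, NormedSpace.exp_eq_tsum_div]
    rw [tsum_congr h2, tsum_mul_left, h3, ← Real.exp_add]
    simp
  nlinarith [norm_nonneg (coherent α)]

lemma norm_stellarFunction_le (ψ : ModeSpace) (α : ℂ) :
    ‖stellarFunction ψ α‖ ≤ ‖ψ‖ * Real.exp (‖α‖ ^ 2 / 2) := by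
  rw [stellarFunction_eq, norm_mul, Complex.norm_real, Real.norm_of_nonneg (Real.exp_nonneg _),
    mul_comm]
  gcongr
  simpa [norm_coherent] using norm_inner_le_norm (𝕜 := ℂ) (coherent (conj α)) ψ

lemma husimi_eq (ψ : ModeSpace) (α : ℂ) :
    husimi ψ α = 1 / Real.pi * (Real.exp (-‖α‖ ^ 2) * ‖stellarFunction ψ (conj α)‖ ^ 2) := by
  rw [husimi, stellarFunction_eq, norm_mul, Complex.norm_real,
    Real.norm_of_nonneg (Real.exp_nonneg _), mul_pow, ← mul_assoc (Real.exp _), ← Real.exp_nat_mul,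
    ← Real.exp_add, Complex.conj_conj, RCLike.norm_conj]
  push_cast
  ring_nf
  simp

lemma husimi_eq_zero_iff (ψ : ModeSpace) (α : ℂ) :
    husimi ψ α = 0 ↔ stellarFunction ψ (conj α) = 0 := by
  rw [husimi_eq]
  simp [Real.pi_ne_zero, Real.exp_ne_zero]

/-- The multiplicity needs no case distinction: the analytic order is already `0` off the roots. -/
lemma husimiMultiplicity_eq (ψ : ModeSpace) (z : ℂ) :
    husimiMultiplicity ψ z = analyticOrderAt (stellarFunction ψ) (conj z) := by
  rw [husimiMultiplicity]
  split_ifs with h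
  · rfl
  · rw [husimi_eq_zero_iff] at h
    exact ((analyticAt_stellarFunction ψ _).analyticOrderAt_eq_zero.2 h).symm

/-- The overlap of a fixed state with the coherent states vanishes at infinity. -/
lemma tendsto_stellarFunction_mul_exp (ψ : ModeSpace) :
    Filter.Tendsto (fun α => ‖stellarFunction ψ α‖ * Real.exp (-(‖α‖ ^ 2 / 2)))
      (Filter.cocompact ℂ) (nhds 0) := by
  have hnorm : ∀ φ α, ‖stellarFunction φ α‖ * Real.exp (-(‖α‖ ^ 2 / 2)) =
      ‖inner ℂ (coherent (conj α)) φ‖ := by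
    intro φ α
    rw [stellarFunction_eq, norm_mul, Complex.norm_real, Real.norm_of_nonneg (Real.exp_nonneg _),
      mul_right_comm, ← Real.exp_add]
    simp
  have hfock : ∀ n, Filter.Tendsto (fun α => ‖stellarFunction (fock n) α‖ *
      Real.exp (-(‖α‖ ^ 2 / 2))) (Filter.cocompact ℂ) (nhds 0) := by
    intro n
    have h := ((Real.tendsto_pow_mul_exp_neg_atTop_nhds_zero n).comp
      (tendsto_norm_cocompact_atTop (E := ℂ))).const_mul (Real.sqrt n.factorial)⁻¹
    rw [mul_zero] at h
    refine squeeze_zero' (Filter.Eventually.of_forall fun α => by positivity) ?_ h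
    filter_upwards [(tendsto_norm_cocompact_atTop (E := ℂ)).eventually_ge_atTop 2] with α hα
    rw [stellarFunction_fock, norm_div, norm_pow, Complex.norm_real,
      Real.norm_of_nonneg (Real.sqrt_nonneg _), div_eq_inv_mul, mul_assoc]
    simp only [Function.comp_apply]
    gcongr
    nlinarith
  rw [Metric.tendsto_nhds]
  intro ε hε
  obtain ⟨s, hs⟩ := (Metric.tendsto_nhds.1 (hasSum_fock ψ) (ε / 2) (half_pos hε)).exists
  have hfin : Filter.Tendsto (fun α => ∑ n ∈ s, ‖ψ n‖ * (‖stellarFunction (fock n) α‖ *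
      Real.exp (-(‖α‖ ^ 2 / 2)))) (Filter.cocompact ℂ) (nhds 0) := by
    simpa using tendsto_finsetSum s fun n _ => (hfock n).const_mul ‖ψ n‖
  filter_upwards [hfin.eventually_lt_const (half_pos hε)] with α hα
  rw [Real.dist_eq, sub_zero, abs_of_nonneg (by positivity), hnorm]
  simp only [hnorm] at hα
  set χ := ∑ n ∈ s, ψ n • fock n
  have h1 : ‖inner ℂ (coherent (conj α)) χ‖ < ε / 2 := by
    refine lt_of_le_of_lt ?_ hα
    rw [inner_sum]
    refine (norm_sum_le _ _).trans (Finset.sum_le_sum fun n _ => ?_)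
    rw [inner_smul_right, norm_mul]
  have h2 : ‖inner ℂ (coherent (conj α)) (ψ - χ)‖ < ε / 2 := by
    refine (norm_inner_le_norm _ _).trans_lt ?_
    rwa [norm_coherent, one_mul, ← dist_eq_norm, dist_comm]
  have h3 : inner ℂ (coherent (conj α)) ψ = inner ℂ (coherent (conj α)) (ψ - χ) +
      inner ℂ (coherent (conj α)) χ := by rw [← inner_add_right, sub_add_cancel]
  rw [h3]
  linarith [norm_add_le (inner ℂ (coherent (conj α)) (ψ - χ)) (inner ℂ (coherent (conj α)) χ)]

/-! ### The creation operator -/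

lemma hasSum_creationSeq (φ : ModeSpace) (α : ℂ) :
    HasSum (fun n => creationSeq (fun k => φ k) n * (α ^ n / (Real.sqrt n.factorial : ℂ)))
      (α * stellarFunction φ α) := by
  rw [← hasSum_nat_add_iff' 1]
  simp only [Finset.range_one, Finset.sum_singleton]
  have h := (hasSum_stellarFunction φ α).mul_left α
  simp only [creationSeq, LinearMap.coe_mk, AddHom.coe_mk, Nat.cast_zero, Real.sqrt_zero,
    Complex.ofReal_zero, zero_mul, sub_zero, Nat.add_sub_cancel]
  refine (congrArg (HasSum · _) (funext fun n => ?_)).mpr h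
  rw [sqrt_factorial_succ]
  push_cast
  have := sqrt_succ_ne_zero n
  have := sqrt_factorial_ne_zero n
  field_simp
  ring

/-- In terms of stellar functions, the creation operator is multiplication by the variable, and
its domain is as large as this allows. -/
lemma mem_graph_creation_iff (φ χ : ModeSpace) :
    (φ, χ) ∈ creation.graph ↔ ∀ α, stellarFunction χ α = α * stellarFunction φ α := by
  have key : (∀ α, stellarFunction χ α = α * stellarFunction φ α) ↔
      creationSeq (fun k => φ k) = fun k => χ k := by
    constructor
    · intro h
      exact fock_coeff_unique (hasSum_creationSeq φ) (fun α => h α ▸ hasSum_stellarFunction χ α)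
    · intro h α
      refine (hasSum_stellarFunction χ α).unique ?_
      have := hasSum_creationSeq φ α
      rwa [h] at this
  rw [key, LinearPMap.mem_graph_iff]
  constructor
  · rintro ⟨⟨y, hy⟩, rfl, h⟩
    exact congrArg (fun (x : ModeSpace) (n : ℕ) => x n) h
  · intro h
    refine ⟨⟨φ, ?_⟩, rfl, Subtype.ext h⟩
    change Memℓp (creationSeq (fun k => φ k)) 2
    rw [h]; exact lp.memℓp χ

/-- A state whose stellar function vanishes at the origin is in the range of the creation
operator. -/
lemma exists_stellarFunction_eq_mul (χ : ModeSpace) (h : stellarFunction χ 0 = 0) :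
    ∃ φ : ModeSpace, ∀ α, stellarFunction χ α = α * stellarFunction φ α := by
  have h0 : χ 0 = 0 := by
    rw [stellarFunction, tsum_eq_single 0 (fun m hm => by simp [hm])] at h
    simpa using h
  have hmem : Memℓp (fun n => χ (n + 1) / (Real.sqrt (n + 1) : ℂ)) 2 := by
    have hs := (lp.memℓp χ).summable (by simp)
    refine memℓp_gen (Summable.of_nonneg_of_le (fun n => by positivity) (fun n => ?_)
      ((summable_nat_add_iff 1).2 hs))
    refine Real.rpow_le_rpow (norm_nonneg _) ?_ (by simp)
    rw [norm_div, Complex.norm_real, Real.norm_of_nonneg (Real.sqrt_nonneg _)]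
    exact div_le_self (norm_nonneg _) (Real.one_le_sqrt.2 (by simp))
  refine ⟨⟨_, hmem⟩, ?_⟩
  rw [← mem_graph_creation_iff, LinearPMap.mem_graph_iff]
  have e : creationSeq (fun n => χ (n + 1) / (Real.sqrt (n + 1) : ℂ)) = fun n => χ n := by
    ext n
    rcases n with _ | n
    · simp [creationSeq, h0]
    · have := sqrt_succ_ne_zero n
      simp only [creationSeq, LinearMap.coe_mk, AddHom.coe_mk, Nat.add_sub_cancel]
      push_cast
      field_simp
  refine ⟨⟨⟨_, hmem⟩, ?_⟩, rfl, Subtype.ext e⟩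
  change Memℓp (creationSeq (fun n => χ (n + 1) / (Real.sqrt (n + 1) : ℂ))) 2
  rw [e]; exact lp.memℓp χ

/-! ### Displacement operators act on stellar functions by translation -/

lemma annihilationFin_creationFin (f : ℕ →₀ ℂ) :
    annihilationFin (creationFin f) = creationFin (annihilationFin f) + f := by
  suffices h : annihilationFin ∘ₗ creationFin =
      creationFin ∘ₗ annihilationFin + LinearMap.id from LinearMap.congr_fun h f
  refine Finsupp.lhom_ext' fun n => LinearMap.ext_ring ?_
  have h : ∀ m : ℕ, (Real.sqrt m : ℂ) * Real.sqrt m = m := fun m => by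
    rw [← Complex.ofReal_mul, Real.mul_self_sqrt (by positivity)]; simp
  have h' := h (n + 1)
  rcases n with _ | n
  · simp [creationFin, annihilationFin]
  · have h'' := h (n + 1)
    push_cast at h' h''
    simp only [creationFin, annihilationFin, LinearMap.comp_apply,
      Finsupp.lsingle_apply, Finsupp.linearCombination_single, Finsupp.smul_single, smul_eq_mul,
      LinearMap.add_apply, LinearMap.id_apply, ← Finsupp.single_add, Nat.add_sub_cancel]
    push_cast
    rw [one_mul, one_mul, h', h'']

lemma generatorFin_apply (β : ℂ) (f : ℕ →₀ ℂ) :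
    generatorFin β f = β • creationFin f - conj β • annihilationFin f := rfl

lemma generatorFin_creationFin (β : ℂ) (f : ℕ →₀ ℂ) :
    generatorFin β (creationFin f) = creationFin (generatorFin β f) - conj β • f := by
  simp only [generatorFin_apply, annihilationFin_creationFin, map_sub, map_smul]
  module

lemma annihilationFin_generatorFin (β : ℂ) (f : ℕ →₀ ℂ) :
    annihilationFin (generatorFin β f) = generatorFin β (annihilationFin f) + β • f := by
  simp only [generatorFin_apply, annihilationFin_creationFin, map_sub, map_smul]
  module

lemma generatorFin_pow_succ_apply (β : ℂ) (k : ℕ) (f : ℕ →₀ ℂ) :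
    (generatorFin β ^ (k + 1)) f = generatorFin β ((generatorFin β ^ k) f) := by
  rw [pow_succ', Module.End.mul_apply]

lemma generatorFin_pow_creationFin (β : ℂ) (k : ℕ) (f : ℕ →₀ ℂ) :
    (generatorFin β ^ (k + 1)) (creationFin f) =
      creationFin ((generatorFin β ^ (k + 1)) f) -
        ((k + 1) * conj β) • (generatorFin β ^ k) f := by
  induction k with
  | zero => simp [generatorFin_creationFin]
  | succ k ih =>
    rw [generatorFin_pow_succ_apply β (k + 1), generatorFin_pow_succ_apply β (k + 1), ih, map_sub,
      generatorFin_creationFin, map_smul, ← generatorFin_pow_succ_apply β k]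
    push_cast
    module

lemma annihilationFin_generatorFin_pow (β : ℂ) (k : ℕ) (f : ℕ →₀ ℂ) :
    annihilationFin ((generatorFin β ^ (k + 1)) f) =
      (generatorFin β ^ (k + 1)) (annihilationFin f) +
        ((k + 1) * β) • (generatorFin β ^ k) f := by
  induction k with
  | zero => simp [annihilationFin_generatorFin]
  | succ k ih =>
    rw [generatorFin_pow_succ_apply β (k + 1), generatorFin_pow_succ_apply β (k + 1),
      annihilationFin_generatorFin, ih, map_add, map_smul, ← generatorFin_pow_succ_apply β k]
    push_cast
    module

lemma hasSum_displacement_fock (β : ℂ) (n : ℕ) :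
    HasSum (expTerm β (Finsupp.single n 1)) (displacement β (fock n)) := by
  have h := (existsUnique_displacement β).choose_spec.1 n
  have h' := hasExpSeries_ofFinsupp β (Finsupp.single n 1)
  rw [ofFinsupp_single, one_smul] at h'
  rw [displacement, h.unique h']
  exact hasSum_expTerm _ _

lemma stellarFunction_ofFinsupp_creationFin (f : ℕ →₀ ℂ) (α : ℂ) :
    stellarFunction (ofFinsupp (creationFin f)) α = α * stellarFunction (ofFinsupp f) α := by
  have h := hasSum_creationSeq (ofFinsupp f) α
  rw [creationSeq_ofFinsupp] at h
  exact (hasSum_stellarFunction _ α).unique h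

/-- The commutation relation `[A, a†] = -β*` of `A = β a† - β* a`, summed over the exponential
series, gives `D(β) a† = (a† - β*) D(β)` on the Fock basis. -/
lemma stellarFunction_displacement_fock_succ (β α : ℂ) (n : ℕ) :
    (Real.sqrt (n + 1) : ℂ) * stellarFunction (displacement β (fock (n + 1))) α =
      (α - conj β) * stellarFunction (displacement β (fock n)) α := by
  have h1 := ((stellarFunctional α).hasSum (hasSum_displacement_fock β (n + 1))).mul_left
    (Real.sqrt (n + 1) : ℂ)
  have h2 := (stellarFunctional α).hasSum (hasSum_displacement_fock β n)
  -- the factor `k` kills the term `k = 0`, where the exponent `k - 1` is truncated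
  have h3 : HasSum (fun k : ℕ => (k : ℂ) / k.factorial *
      stellarFunction (ofFinsupp ((generatorFin β ^ (k - 1)) (Finsupp.single n 1))) α)
      (stellarFunction (displacement β (fock n)) α) := by
    rw [← hasSum_nat_add_iff' 1]
    rw [stellarFunctional_apply] at h2
    simp only [Finset.range_one, Finset.sum_singleton, Nat.cast_zero, zero_div, zero_mul, sub_zero]
    refine (congrArg (HasSum · _) (funext fun k => ?_)).mpr h2
    rw [expTerm, stellarFunctional_apply, stellarFunction_smul, Nat.factorial_succ,
      Nat.add_sub_cancel]
    have : (k.factorial : ℂ) ≠ 0 := by exact_mod_cast k.factorial_ne_zero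
    have : ((k : ℂ) + 1) ≠ 0 := by exact_mod_cast k.succ_ne_zero
    push_cast
    field_simp
  have h4 := (h2.mul_left α).sub (h3.mul_left (conj β))
  rw [stellarFunctional_apply] at h1 h4
  rw [sub_mul]
  refine h1.unique ((congrArg (HasSum · _) (funext fun k => ?_)).mpr h4)
  have hc : creationFin (Finsupp.single n 1) =
      (Real.sqrt (n + 1) : ℂ) • Finsupp.single (n + 1) (1 : ℂ) := by
    simp [creationFin]
  have h5 : (Real.sqrt (n + 1) : ℂ) * stellarFunctional α (expTerm β (Finsupp.single (n + 1) 1) k)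
      = (k.factorial : ℂ)⁻¹ *
        stellarFunction (ofFinsupp ((generatorFin β ^ k) (creationFin (Finsupp.single n 1)))) α := by
    rw [expTerm, stellarFunctional_apply, stellarFunction_smul, hc, map_smul,
      map_smul, stellarFunction_smul]
    ring
  rw [h5, expTerm, stellarFunctional_apply, stellarFunction_smul]
  rcases k with _ | k
  · simp [stellarFunction_ofFinsupp_creationFin]
  · rw [generatorFin_pow_creationFin, sub_eq_add_neg, ← neg_smul, map_add, map_smul, stellarFunction_add, stellarFunction_smul,
      stellarFunction_ofFinsupp_creationFin, Nat.add_sub_cancel]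
    push_cast
    ring

/-- The displaced vacuum satisfies `a D(β)|0⟩ = β D(β)|0⟩`, coefficientwise. -/
lemma displacement_fock_zero_succ (β : ℂ) (n : ℕ) :
    (Real.sqrt (n + 1) : ℂ) * displacement β (fock 0) (n + 1) =
      β * displacement β (fock 0) n := by
  have hcoord : ∀ (m : ℕ) (χ : ModeSpace), innerSL ℂ (fock m) χ = χ m := by
    intro m χ
    rw [innerSL_apply_apply, fock, lp.inner_single_left]; simp
  have h1 := ((innerSL ℂ (fock (n + 1))).hasSum (hasSum_displacement_fock β 0)).mul_left
    (Real.sqrt (n + 1) : ℂ)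
  have h2 := ((innerSL ℂ (fock n)).hasSum (hasSum_displacement_fock β 0)).mul_left β
  simp only [hcoord] at h1 h2
  refine h1.unique ?_
  have h3 : ∀ k, (Real.sqrt (n + 1) : ℂ) * expTerm β (Finsupp.single 0 1) k (n + 1) =
      (k.factorial : ℂ)⁻¹ *
        ofFinsupp (annihilationFin ((generatorFin β ^ k) (Finsupp.single 0 1))) n := by
    intro k
    have := congrFun (annihilationSeq_ofFinsupp ((generatorFin β ^ k) (Finsupp.single 0 1))) n
    rw [← this]
    simp only [annihilationSeq, expTerm, LinearMap.coe_mk, AddHom.coe_mk, lp.coeFn_smul,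
      Pi.smul_apply, smul_eq_mul]
    ring
  have h0 : annihilationFin (Finsupp.single 0 1) = 0 := by simp [annihilationFin]
  rw [← hasSum_nat_add_iff' 1]
  simp only [Finset.range_one, Finset.sum_singleton, h3]
  rw [pow_zero, Module.End.one_apply, h0, map_zero]
  simp only [lp.coeFn_zero, Pi.zero_apply, mul_zero, sub_zero]
  refine (congrArg (HasSum · _) (funext fun k => ?_)).mpr h2
  rw [annihilationFin_generatorFin_pow, h0, map_zero, zero_add, map_smul, expTerm, Nat.factorial_succ]
  simp only [lp.coeFn_smul, Pi.smul_apply, smul_eq_mul]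
  have : (k.factorial : ℂ) ≠ 0 := by exact_mod_cast k.factorial_ne_zero
  have : ((k : ℂ) + 1) ≠ 0 := by exact_mod_cast k.succ_ne_zero
  push_cast
  field_simp

lemma stellarFunction_displacement_vacuum (β α : ℂ) :
    stellarFunction (displacement β (fock 0)) α =
      displacement β (fock 0) 0 * Complex.exp (β * α) := by
  have hcoef : ∀ n : ℕ, displacement β (fock 0) n =
      displacement β (fock 0) 0 * (β ^ n / (Real.sqrt n.factorial : ℂ)) := by
    intro n
    induction n with
    | zero => simp
    | succ n ih =>
      have h := displacement_fock_zero_succ β n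
      rw [ih] at h
      have h1 := sqrt_succ_ne_zero n
      have h2 := sqrt_factorial_ne_zero n
      refine mul_left_cancel₀ h1 (h.trans ?_)
      rw [sqrt_factorial_succ]
      field_simp
      ring
  have hs : HasSum (fun n : ℕ => (β * α) ^ n / (n.factorial : ℂ)) (Complex.exp (β * α)) := by
    rw [Complex.exp_eq_exp_ℂ]
    exact NormedSpace.expSeries_div_hasSum_exp (β * α)
  refine (hasSum_stellarFunction _ α).unique
    ((congrArg (HasSum · _) (funext fun n => ?_)).mpr (hs.mul_left _))
  have h2 := sqrt_factorial_ne_zero n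
  have h3 : (Real.sqrt n.factorial : ℂ) * Real.sqrt n.factorial = n.factorial := by
    rw [← Complex.ofReal_mul, Real.mul_self_sqrt (by positivity)]; simp
  rw [hcoef n, mul_pow, ← h3]
  field_simp

/-- The displacement `D(β)` translates stellar functions by `β*` and multiplies them by a zero-free
exponential. The value of the constant `c` is immaterial: it cancels in `D(β) a† D†(β)`. -/
lemma exists_stellarFunction_displacement (β : ℂ) :
    ∃ c : ℂ, c ≠ 0 ∧ ∀ (φ : ModeSpace) (α : ℂ), stellarFunction (displacement β φ) α =
      c * Complex.exp (β * α) * stellarFunction φ (α - conj β) := by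
  refine ⟨displacement β (fock 0) 0, fun h0 => ?_, fun φ α => ?_⟩
  · have h : displacement β (fock 0) = 0 := by
      apply stellarFunction_injective
      funext α
      rw [stellarFunction_displacement_vacuum, h0, stellarFunction_zero, zero_mul]
    have h1 := (displacement β).norm_map (fock 0)
    rw [h, norm_zero, fock, lp.norm_single (by simp)] at h1
    simp at h1
  · have hfock : ∀ n, stellarFunction (displacement β (fock n)) α =
        displacement β (fock 0) 0 * Complex.exp (β * α) *
          stellarFunction (fock n) (α - conj β) := by
      intro n
      induction n with
      | zero => simp [stellarFunction_displacement_vacuum, stellarFunction_fock]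
      | succ n ih =>
        have h := stellarFunction_displacement_fock_succ β α n
        rw [ih, stellarFunction_fock] at h
        rw [stellarFunction_fock, sqrt_factorial_succ]
        have h1 := sqrt_succ_ne_zero n
        have h2 := sqrt_factorial_ne_zero n
        refine mul_left_cancel₀ h1 (h.trans ?_)
        field_simp
        ring
    have h := clm_ext_fock
      (S := (stellarFunctional α).comp
        (displacement β).toContinuousLinearEquiv.toContinuousLinearMap)
      (T := (displacement β (fock 0) 0 * Complex.exp (β * α)) •
        stellarFunctional (α - conj β))
      (fun n => by simpa [stellarFunctional_apply] using hfock n)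
    simpa [stellarFunctional_apply] using congrArg (fun T : ModeSpace →L[ℂ] ℂ => T φ) h

/-! ### Displaced creation operators -/

lemma mem_graph_pcomp_iff (f g : ModeSpace →ₗ.[ℂ] ModeSpace) (φ χ : ModeSpace) :
    (φ, χ) ∈ (pcomp f g).graph ↔ ∃ η, (φ, η) ∈ g.graph ∧ (η, χ) ∈ f.graph := by
  constructor
  · intro h
    obtain ⟨⟨x, hx⟩, rfl, rfl⟩ := (LinearPMap.mem_graph_iff _).1 h
    obtain ⟨y, hy, rfl⟩ := id hx
    exact ⟨g y, g.mem_graph y, f.mem_graph ⟨g y, hy⟩⟩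
  · rintro ⟨η, h1, h2⟩
    obtain ⟨y, rfl, rfl⟩ := (LinearPMap.mem_graph_iff _).1 h1
    obtain ⟨z, hz, rfl⟩ := (LinearPMap.mem_graph_iff _).1 h2
    replace hz : (z : ModeSpace) = g y := hz
    have hd : g y ∈ f.domain := hz ▸ z.2
    refine (LinearPMap.mem_graph_iff _).2 ⟨⟨y, ⟨y, hd, rfl⟩⟩, rfl, ?_⟩
    exact congrArg f (Subtype.ext hz.symm)

lemma mem_graph_ofUnitary_iff (U : ModeSpace ≃ₗᵢ[ℂ] ModeSpace) (φ χ : ModeSpace) :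
    (φ, χ) ∈ (ofUnitary U).graph ↔ U φ = χ := by
  rw [LinearPMap.mem_graph_iff]
  constructor
  · rintro ⟨y, rfl, h⟩; exact h
  · rintro h; exact ⟨⟨φ, trivial⟩, rfl, h⟩

/-- In terms of stellar functions, `D(β) a† D†(β)` is multiplication by `α - β*`, and its domain
is as large as this allows. -/
lemma mem_graph_displacedCreation_iff (β : ℂ) (φ χ : ModeSpace) :
    (φ, χ) ∈ (displacedCreation β).graph ↔
      ∀ α, stellarFunction χ α = (α - conj β) * stellarFunction φ α := by
  obtain ⟨c, hc, h⟩ := exists_stellarFunction_displacement β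
  have h' : ∀ φ α, stellarFunction φ α = c * Complex.exp (β * α) *
      stellarFunction ((displacement β).symm φ) (α - conj β) := fun φ α => by
    rw [← h, LinearIsometryEquiv.apply_symm_apply]
  have e : (φ, χ) ∈ (displacedCreation β).graph ↔
      ((displacement β).symm φ, (displacement β).symm χ) ∈ creation.graph := by
    simp only [displacedCreation, mem_graph_pcomp_iff, mem_graph_ofUnitary_iff]
    constructor
    · rintro ⟨η, ⟨_, rfl, h⟩, rfl⟩
      simpa using h
    · intro h
      exact ⟨_, ⟨_, rfl, h⟩, by simp⟩
  rw [e, mem_graph_creation_iff]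
  constructor
  · intro hm α
    rw [h' χ, h' φ, hm]; ring
  · intro hm α
    have := hm (α + conj β)
    rw [h' χ, h' φ, add_sub_cancel_right] at this
    have hne : c * Complex.exp (β * (α + conj β)) ≠ 0 := mul_ne_zero hc (Complex.exp_ne_zero _)
    refine mul_left_cancel₀ hne (this.trans ?_)
    ring

/-- Every zero of a stellar function can be divided out within the Hilbert space. -/
lemma exists_mem_graph_displacedCreation (β : ℂ) (χ : ModeSpace)
    (hχ : stellarFunction χ (conj β) = 0) : ∃ φ, (φ, χ) ∈ (displacedCreation β).graph := by
  obtain ⟨c, hc, h⟩ := exists_stellarFunction_displacement β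
  have h0 : stellarFunction ((displacement β).symm χ) 0 = 0 := by
    have := h ((displacement β).symm χ) (conj β)
    rw [LinearIsometryEquiv.apply_symm_apply, hχ, sub_self] at this
    simpa [hc, Complex.exp_ne_zero] using this.symm
  obtain ⟨φ, hφ⟩ := exists_stellarFunction_eq_mul _ h0
  refine ⟨displacement β φ, (mem_graph_displacedCreation_iff _ _ _).2 fun α => ?_⟩
  have := h ((displacement β).symm χ) α
  rw [LinearIsometryEquiv.apply_symm_apply, hφ] at this
  rw [this, h]; ring

lemma displacedCreationProd_succ {r : ℕ} (β : Fin (r + 1) → ℂ) :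
    displacedCreationProd β =
      pcomp (displacedCreation (β 0)) (displacedCreationProd fun n : Fin r => β n.succ) := by
  simp [displacedCreationProd, List.ofFn_succ]

lemma stellarFunction_of_mem_graph_displacedCreationProd {r : ℕ} (β : Fin r → ℂ)
    {φ χ : ModeSpace} (h : (φ, χ) ∈ (displacedCreationProd β).graph) (α : ℂ) :
    stellarFunction χ α = (∏ n, (α - conj (β n))) * stellarFunction φ α := by
  induction r generalizing χ with
  | zero =>
    rw [displacedCreationProd, List.ofFn_zero, List.foldr_nil, mem_graph_ofUnitary_iff] at h
    simp [← h]
  | succ r ih =>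
    rw [displacedCreationProd_succ, mem_graph_pcomp_iff] at h
    obtain ⟨η, h1, h2⟩ := h
    rw [(mem_graph_displacedCreation_iff _ _ _).1 h2, ih _ h1, Fin.prod_univ_succ, mul_assoc]

/-! ### Zero-free stellar functions are Gaussian -/

/-- A zero-free entire function is the exponential of an entire function. -/
lemma exists_differentiable_eq_exp {F : ℂ → ℂ} (hF : Differentiable ℂ F) (h0 : ∀ z, F z ≠ 0) :
    ∃ h : ℂ → ℂ, Differentiable ℂ h ∧ ∀ z, F z = Complex.exp (h z) := by
  have hd : Differentiable ℂ fun z => deriv F z / F z := hF.deriv.fun_div hF h0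
  obtain ⟨g, hg⟩ := hd.isExactOn_univ
  replace hg := fun z => hg z (Set.mem_univ z)
  -- `g` is a primitive of `F' / F`, so `F * exp (-g)` is constant
  have hk : ∀ z, HasDerivAt (fun z => F z * Complex.exp (-g z)) 0 z := fun z => by
    have h := (hF z).hasDerivAt.mul ((hg z).fun_neg.cexp)
    convert! h using 1
    field_simp [h0 z]
    ring
  have hconst : ∀ z, F z * Complex.exp (-g z) = F 0 * Complex.exp (-g 0) := fun z =>
    is_const_of_deriv_eq_zero (fun z => (hk z).differentiableAt) (fun z => (hk z).deriv) z 0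
  have hne : F 0 * Complex.exp (-g 0) ≠ 0 := mul_ne_zero (h0 0) (Complex.exp_ne_zero _)
  refine ⟨fun z => g z + Complex.log (F 0 * Complex.exp (-g 0)),
    fun z => (hg z).differentiableAt.add_const _, fun z => ?_⟩
  rw [Complex.exp_add, Complex.exp_log hne, ← hconst z, Complex.exp_neg]
  have := Complex.exp_ne_zero (g z)
  field_simp

/-- An entire function whose real part grows at most quadratically is a quadratic polynomial. -/
lemma eq_quadratic_of_re_le {h : ℂ → ℂ} (hd : Differentiable ℂ h) {L : ℝ}
    (hL : ∀ z, (h z).re ≤ L + ‖z‖ ^ 2 / 2) :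
    ∃ a b c : ℂ, ∀ z, h z = a + b * z + c * z ^ 2 := by
  set C : ℝ := 2 * (|L| + 1) + 3 * ‖h 0‖ with hC
  have hgrowth : ∀ R : ℝ, 0 < R → ∀ z ∈ Metric.sphere (0 : ℂ) R, ‖h z‖ ≤ 4 * R ^ 2 + C := by
    intro R hR z hz
    have hz' : ‖z‖ = R := by simpa using hz
    have hM : 0 < |L| + 1 + 2 * R ^ 2 := by positivity
    have hmaps : Set.MapsTo h (Metric.ball 0 (2 * R)) {z | z.re ≤ |L| + 1 + 2 * R ^ 2} := by
      intro w hw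
      have hw' : ‖w‖ < 2 * R := by simpa using hw
      have := hL w
      have h2 : ‖w‖ ^ 2 ≤ (2 * R) ^ 2 := by gcongr
      simp only [Set.mem_ofPred_eq]
      nlinarith [le_abs_self L]
    -- Borel–Carathéodory on the ball of radius `2R` bounds `h` on the circle of radius `R`
    have := Complex.borelCaratheodory hM hd.differentiableOn hmaps (by positivity)
      (z := z) (by simp only [mem_ball_zero_iff]; linarith)
    rw [hz'] at this
    refine this.trans (le_of_eq ?_)
    rw [show 2 * R - R = R by ring, hC]
    field_simp
    ring
  have hzero : ∀ n, 3 ≤ n → iteratedDeriv n h 0 = 0 := by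
    intro n hn
    have hb : ∀ R : ℝ, 1 ≤ R → ‖iteratedDeriv n h 0‖ ≤ n.factorial * (4 + |C|) * R⁻¹ := by
      intro R hR
      have hR0 : 0 < R := by linarith
      refine (Complex.norm_iteratedDeriv_le_of_forall_mem_sphere_norm_le n hR0
        hd.diffContOnCl (hgrowth R hR0)).trans ?_
      have h1 : 4 * R ^ 2 + C ≤ (4 + |C|) * R ^ 2 := by
        nlinarith [le_abs_self C, abs_nonneg C, one_le_pow₀ hR (n := 2)]
      have h2 : R ^ 3 ≤ R ^ n := pow_le_pow_right₀ hR hn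
      calc (n.factorial : ℝ) * (4 * R ^ 2 + C) / R ^ n
          ≤ n.factorial * ((4 + |C|) * R ^ 2) / R ^ 3 := by gcongr
        _ = _ := by field_simp
    have hlim : Filter.Tendsto (fun R : ℝ => n.factorial * (4 + |C|) * R⁻¹) Filter.atTop
        (nhds 0) := by
      simpa using tendsto_inv_atTop_zero.const_mul ((n.factorial : ℝ) * (4 + |C|))
    have := ge_of_tendsto hlim ((Filter.eventually_ge_atTop 1).mono hb)
    exact norm_le_zero_iff.1 this
  refine ⟨h 0, deriv h 0, iteratedDeriv 2 h 0 / 2, fun z => ?_⟩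
  rw [← Complex.taylorSeries_eq_of_entire' 0 z hd, tsum_eq_sum (s := Finset.range 3)]
  · simp only [Finset.sum_range_succ, Finset.range_zero, Finset.sum_empty, iteratedDeriv_zero,
      iteratedDeriv_one, Nat.factorial]
    push_cast
    ring
  · intro n hn
    rw [hzero n (by simpa using hn)]
    simp

/-- A zero-free stellar function is the exponential of a quadratic polynomial, by the theorems of
Borel–Carathéodory and Liouville; the quadratic coefficient is small because the overlaps with
coherent states tend to `0` in every direction. -/
lemma exists_stellarFunction_eq_exp (φ : ModeSpace) (h0 : ∀ α, stellarFunction φ α ≠ 0) :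
    ∃ a b c : ℂ, ‖c‖ < 1 / 2 ∧
      ∀ α, stellarFunction φ α = Complex.exp (a + b * α + c * α ^ 2) := by
  obtain ⟨h, hd, hexp⟩ := exists_differentiable_eq_exp (differentiable_stellarFunction φ) h0
  have hφ : 0 < ‖φ‖ := by
    rw [norm_pos_iff]
    rintro rfl
    exact h0 0 (stellarFunction_zero 0)
  obtain ⟨a, b, c, habc⟩ := eq_quadratic_of_re_le hd (L := Real.log ‖φ‖) fun z => by
    have := norm_stellarFunction_le φ z
    rw [hexp, Complex.norm_exp] at this
    rwa [← Real.exp_le_exp, Real.exp_add, Real.exp_log hφ]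
  have hF : ∀ α, stellarFunction φ α = Complex.exp (a + b * α + c * α ^ 2) := fun α => by
    rw [hexp, habc]
  refine ⟨a, b, c, ?_, hF⟩
  by_contra! hc
  have hc0 : (‖c‖ : ℂ) ≠ 0 := by
    have : 0 < ‖c‖ := by linarith
    exact_mod_cast this.ne'
  -- a direction `u` in which `c α ^ 2` is positive and `b α` has nonnegative real part
  obtain ⟨u, hu1, hu2, hu3⟩ : ∃ u : ℂ, ‖u‖ = 1 ∧ c * u ^ 2 = ‖c‖ ∧ 0 ≤ (b * u).re := by
    obtain ⟨w, hw⟩ := IsAlgClosed.exists_pow_nat_eq (conj c / ‖c‖) (n := 2) (by norm_num)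
    have hw1 : ‖w‖ = 1 := by
      have : ‖w‖ ^ 2 = 1 := by
        rw [← norm_pow, hw, norm_div, RCLike.norm_conj, Complex.norm_real, norm_norm,
          div_self (by exact_mod_cast hc0)]
      nlinarith [norm_nonneg w]
    have hw2 : c * w ^ 2 = ‖c‖ := by
      rw [hw, ← mul_div_assoc, Complex.mul_conj, Complex.normSq_eq_norm_sq]
      push_cast
      field_simp
    rcases le_total 0 (b * w).re with hb | hb
    · exact ⟨w, hw1, hw2, hb⟩
    · refine ⟨-w, by simpa using hw1, by simpa using hw2, ?_⟩
      rw [mul_neg, Complex.neg_re]; linarith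
  have hray : Filter.Tendsto (fun t : ℝ => (t : ℂ) * u) Filter.atTop (Filter.cocompact ℂ) := by
    refine tendsto_cocompact_of_tendsto_dist_comp_atTop 0 ?_
    simpa [hu1] using Filter.tendsto_abs_atTop_atTop
  have hlim := (tendsto_stellarFunction_mul_exp φ).comp hray
  have hge : ∀ᶠ t : ℝ in Filter.atTop, Real.exp a.re ≤
      ((fun α => ‖stellarFunction φ α‖ * Real.exp (-(‖α‖ ^ 2 / 2))) ∘
        fun t : ℝ => (t : ℂ) * u) t := by
    filter_upwards [Filter.eventually_ge_atTop 0] with t ht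
    have e : a + b * (t * u) + c * (t * u) ^ 2 = a + t * (b * u) + (t ^ 2 * ‖c‖ : ℝ) := by
      push_cast
      rw [← hu2]; ring
    simp only [Function.comp_apply]
    rw [hF, Complex.norm_exp, ← Real.exp_add, Real.exp_le_exp, e, norm_mul, hu1,
      Complex.norm_real, mul_one, Real.norm_eq_abs, sq_abs, Complex.add_re, Complex.add_re,
      Complex.re_ofReal_mul, Complex.ofReal_re]
    nlinarith [mul_nonneg ht hu3, mul_nonneg (sq_nonneg t) (sub_nonneg.2 hc)]
  exact absurd (ge_of_tendsto hlim hge) (not_le.2 (Real.exp_pos _))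

lemma isGaussianState_of_stellarFunction_ne_zero (φ : ModeSpace) (hφ : ‖φ‖ = 1)
    (h0 : ∀ α, stellarFunction φ α ≠ 0) : IsGaussianState φ := by
  obtain ⟨a, b, c, hc, hF⟩ := exists_stellarFunction_eq_exp φ h0
  have hc2 : c.re ^ 2 + c.im ^ 2 < 1 / 4 := by
    have h1 := Complex.normSq_eq_norm_sq c
    rw [Complex.normSq_apply] at h1
    nlinarith [norm_nonneg c]
  have hD : 0 < (1 - 2 * c.re) * (1 + 2 * c.re) - (-2 * c.im) ^ 2 := by nlinarith
  have hA : 0 < 1 - 2 * c.re := by nlinarith [sq_nonneg c.im, sq_nonneg (c.re + 1 / 2)]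
  set A := 1 - 2 * c.re with hA'
  set C := 1 + 2 * c.re with hC'
  set B := -2 * c.im with hB'
  -- the centre solves the linear system that cancels the linear terms of the exponent
  set x := (C * b.re - B * b.im) / (A * C - B ^ 2) with hx
  set y := (A * b.im - B * b.re) / (A * C - B ^ 2) with hy
  have e1 : A * x + B * y = b.re := by
    rw [hx, hy, ← mul_div_assoc, ← mul_div_assoc, ← add_div, div_eq_iff hD.ne']; ring
  have e2 : B * x + C * y = b.im := by
    rw [hx, hy, ← mul_div_assoc, ← mul_div_assoc, ← add_div, div_eq_iff hD.ne']; ring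
  refine ⟨hφ, 1 / Real.pi * Real.exp (2 * a.re + (A * x ^ 2 + 2 * B * x * y + C * y ^ 2)),
    A, B, C, ⟨x, y⟩, by positivity, hA, by linarith, fun α => ?_⟩
  rw [husimi_eq, hF, Complex.norm_exp, ← Real.exp_nat_mul, ← Real.exp_add, mul_assoc,
    ← Real.exp_add]
  congr 2
  have hn : ‖α‖ ^ 2 = α.re ^ 2 + α.im ^ 2 := by
    rw [← Complex.normSq_eq_norm_sq, Complex.normSq_apply]; ring
  have hre : (a + b * conj α + c * conj α ^ 2).re = a.re + (b.re * α.re + b.im * α.im) +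
      (c.re * (α.re ^ 2 - α.im ^ 2) + 2 * c.im * α.re * α.im) := by
    simp [pow_two]; ring
  rw [hn, hre, ← e1, ← e2, hA', hB', hC']
  push_cast
  ring

lemma IsGaussianState.stellarFunction_ne_zero {φ : ModeSpace} (h : IsGaussianState φ) (α : ℂ) :
    stellarFunction φ α ≠ 0 := by
  obtain ⟨-, K, A, B, C, μ, hK, -, -, hQ⟩ := h
  have h1 : husimi φ (conj α) ≠ 0 := by
    rw [hQ]; positivity
  rwa [Ne, husimi_eq_zero_iff, Complex.conj_conj] at h1

/-! ### Roots of the Husimi function -/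

lemma husimiMultiplicity_of_mem_graph_displacedCreation {β : ℂ} {φ χ : ModeSpace}
    (h : (φ, χ) ∈ (displacedCreation β).graph) (z : ℂ) [Decidable (β = z)] :
    husimiMultiplicity χ z = (if β = z then 1 else 0) + husimiMultiplicity φ z := by
  have hf : stellarFunction χ = (fun α => α - conj β) * stellarFunction φ :=
    funext ((mem_graph_displacedCreation_iff _ _ _).1 h)
  rw [husimiMultiplicity_eq, husimiMultiplicity_eq, hf,
    analyticOrderAt_mul (by fun_prop) (analyticAt_stellarFunction _ _)]
  split_ifs with hz
  · rw [hz, analyticOrderAt_id_sub_const_self]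
  · rw [analyticOrderAt_id_sub_const_of_ne fun e => hz ((starRingEnd ℂ).injective e).symm]

lemma card_fiber_succ {r : ℕ} (β : Fin (r + 1) → ℂ) (z : ℂ) [Decidable (β 0 = z)] :
    Nat.card {n : Fin (r + 1) // β n = z} =
      (if β 0 = z then 1 else 0) + Nat.card {n : Fin r // β n.succ = z} := by
  classical
  rw [Nat.card_eq_fintype_card, Nat.card_eq_fintype_card, Fintype.card_subtype,
    Fintype.card_subtype, Finset.card_filter, Finset.card_filter, Fin.sum_univ_succ]
  congr

lemma husimiMultiplicity_of_mem_graph_displacedCreationProd {r : ℕ} {β : Fin r → ℂ}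
    {φ χ : ModeSpace} (h : (φ, χ) ∈ (displacedCreationProd β).graph) (z : ℂ) :
    husimiMultiplicity χ z =
      (Nat.card {n : Fin r // β n = z} : ℕ∞) + husimiMultiplicity φ z := by
  classical
  induction r generalizing χ with
  | zero =>
    rw [displacedCreationProd, List.ofFn_zero, List.foldr_nil, mem_graph_ofUnitary_iff] at h
    simp [← h]
  | succ r ih =>
    rw [displacedCreationProd_succ, mem_graph_pcomp_iff] at h
    obtain ⟨η, h1, h2⟩ := h
    rw [husimiMultiplicity_of_mem_graph_displacedCreation h2, ih h1, card_fiber_succ, ← add_assoc]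
    push_cast
    rfl

lemma husimiMultiplicity_eq_zero_iff (ψ : ModeSpace) (z : ℂ) :
    husimiMultiplicity ψ z = 0 ↔ stellarFunction ψ (conj z) ≠ 0 := by
  rw [husimiMultiplicity_eq, (analyticAt_stellarFunction ψ _).analyticOrderAt_eq_zero]

/-- Dividing out the listed roots one after the other leaves a state with zero-free stellar
function. -/
lemma IsHusimiRoots.exists_mem_graph {r : ℕ} {β : Fin r → ℂ} {χ : ModeSpace}
    (h : IsHusimiRoots χ β) :
    ∃ φ, (φ, χ) ∈ (displacedCreationProd β).graph ∧ ∀ α, stellarFunction φ α ≠ 0 := by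
  classical
  induction r generalizing χ with
  | zero =>
    refine ⟨χ, ?_, fun α => ?_⟩
    · rw [displacedCreationProd, List.ofFn_zero, List.foldr_nil, mem_graph_ofUnitary_iff]
      rfl
    · have := h (conj α)
      rwa [Nat.card_of_isEmpty, Nat.cast_zero, husimiMultiplicity_eq_zero_iff,
        Complex.conj_conj] at this
  | succ r ih =>
    have h0 : stellarFunction χ (conj (β 0)) = 0 := by
      by_contra hne
      have := h (β 0)
      rw [(husimiMultiplicity_eq_zero_iff _ _).2 hne, card_fiber_succ, if_pos rfl] at this
      exact absurd (Nat.cast_eq_zero.1 this.symm) (by omega)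
    obtain ⟨η, hη⟩ := exists_mem_graph_displacedCreation (β 0) χ h0
    obtain ⟨φ, hφ, hφ0⟩ := ih (χ := η) (β := fun n => β n.succ) fun z => by
      have := h z
      rw [husimiMultiplicity_of_mem_graph_displacedCreation hη, card_fiber_succ,
        Nat.cast_add, Nat.cast_ite, Nat.cast_one, Nat.cast_zero] at this
      exact ENat.add_right_injective_of_ne_top (by split_ifs <;> simp) this
    refine ⟨φ, ?_, hφ0⟩
    rw [displacedCreationProd_succ, mem_graph_pcomp_iff]
    exact ⟨η, hφ, hη⟩

/-- A function with values in `ℕ∞` whose finite sums have a finite supremum `r` counts the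
multiplicities in a list of length `r`. -/
lemma exists_card_fiber_eq {ι : Type*} {m : ι → ℕ∞} {r : ℕ}
    (h : ⨆ s : Finset ι, ∑ z ∈ s, m z = (r : ℕ∞)) :
    ∃ β : Fin r → ι, ∀ z, m z = (Nat.card {n : Fin r // β n = z} : ℕ∞) := by
  classical
  obtain ⟨s, hs⟩ := ENat.exists_eq_iSup_of_lt_top
    (f := fun s : Finset ι => ∑ z ∈ s, m z) (h ▸ ENat.natCast_lt_top r)
  have hle : ∀ t : Finset ι, ∑ z ∈ t, m z ≤ r := fun t =>
    h ▸ le_iSup (fun s : Finset ι => ∑ z ∈ s, m z) t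
  rw [h] at hs
  have hfin : ∀ z, m z ≠ ⊤ := fun z => by
    have := hle {z}
    rw [Finset.sum_singleton] at this
    exact ne_top_of_le_ne_top (ENat.natCast_ne_top r) this
  -- `s` attains the supremum, so `m` vanishes outside `s`
  have hout : ∀ z, z ∉ s → m z = 0 := by
    intro z hz
    have := hle (insert z s)
    rw [Finset.sum_insert hz, hs] at this
    have h2 : m z + r ≤ 0 + r := by simpa using this
    simpa using (ENat.add_le_add_iff_right (ENat.natCast_ne_top r)).1 h2
  have hcard : Fintype.card (Σ z : s, Fin (m z).toNat) = r := by
    rw [Fintype.card_sigma]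
    simp only [Fintype.card_fin]
    have : ((∑ z : s, (m z).toNat : ℕ) : ℕ∞) = r := by
      rw [← hs, Nat.cast_sum, ← Finset.sum_coe_sort s]
      exact Finset.sum_congr rfl fun z _ => ENat.natCast_toNat (hfin z)
    exact_mod_cast this
  let e : Fin r ≃ Σ z : s, Fin (m z).toNat := (Fintype.equivFinOfCardEq hcard).symm
  refine ⟨fun n => (e n).1, fun z => ?_⟩
  by_cases hz : z ∈ s
  · have h1 : {n : Fin r // ((e n).1 : ι) = z} ≃ {x : Σ z : s, Fin (m z).toNat // x.1 = ⟨z, hz⟩} :=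
      e.subtypeEquiv fun n => by simp [Subtype.ext_iff]
    rw [Nat.card_congr (h1.trans (Equiv.sigmaSubtype (⟨z, hz⟩ : s))), Nat.card_fin,
      ENat.natCast_toNat (hfin z)]
  · have : IsEmpty {n : Fin r // ((e n).1 : ι) = z} := ⟨fun n => hz (n.2 ▸ (e n.1).1.2)⟩
    rw [hout z hz, Nat.card_of_isEmpty, Nat.cast_zero]

lemma exists_isHusimiRoots {ψ : ModeSpace} {r : ℕ} (hr : stellarRank ψ = (r : ℕ∞)) :
    ∃ β : Fin r → ℂ, IsHusimiRoots ψ β := by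
  obtain ⟨β, hβ⟩ := exists_card_fiber_eq hr
  refine ⟨fun n => conj (β n), fun z => ?_⟩
  rw [husimiMultiplicity_eq, hβ, Nat.card_congr]
  exact Equiv.subtypeEquivRight fun n => by
    rw [← (starRingEnd ℂ).injective.eq_iff, Complex.conj_conj]

/-! ### Existence and uniqueness of the decomposition -/

lemma IsHusimiRoots.exists_isStellarDecomposition {ψ : ModeSpace} {r : ℕ} {β : Fin r → ℂ}
    (h : IsHusimiRoots ψ β) :
    ∃ (G : ModeSpace) (𝒩 : ℝ), 0 < 𝒩 ∧ IsStellarDecomposition ψ β G (𝒩 : ℂ) := by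
  obtain ⟨φ, hφ, h0⟩ := h.exists_mem_graph
  have hpos : 0 < ‖φ‖ := by
    rw [norm_pos_iff]
    rintro rfl
    exact h0 0 (stellarFunction_zero 0)
  have hne : (‖φ‖ : ℂ)⁻¹ ≠ 0 := inv_ne_zero (by exact_mod_cast hpos.ne')
  refine ⟨(‖φ‖ : ℂ)⁻¹ • φ, ‖φ‖⁻¹, inv_pos.2 hpos, ?_, by simpa using hpos.ne', ?_⟩
  · refine isGaussianState_of_stellarFunction_ne_zero _ ?_ fun α => ?_
    · rw [norm_smul, norm_inv, Complex.norm_real, norm_norm, inv_mul_cancel₀ hpos.ne']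
    · rw [stellarFunction_smul]
      exact mul_ne_zero hne (h0 α)
  · obtain ⟨y, hy, hψ⟩ := (LinearPMap.mem_graph_iff _).1
      ((displacedCreationProd β).graph.smul_mem (‖φ‖ : ℂ)⁻¹ hφ)
    replace hy : (y : ModeSpace) = (‖φ‖ : ℂ)⁻¹ • φ := hy
    replace hψ : displacedCreationProd β y = (‖φ‖ : ℂ)⁻¹ • ψ := hψ
    obtain ⟨y, hyd⟩ := y
    subst hy
    refine ⟨hyd, ?_⟩
    rw [hψ, Complex.ofReal_inv, inv_smul_smul₀ hne]

lemma IsStellarDecomposition.mem_graph {ψ : ModeSpace} {r : ℕ} {β : Fin r → ℂ} {G : ModeSpace}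
    {𝒩 : ℂ} (h : IsStellarDecomposition ψ β G 𝒩) :
    (𝒩⁻¹ • G, ψ) ∈ (displacedCreationProd β).graph := by
  obtain ⟨hG, hψ⟩ := h.eq_smul
  rw [hψ]
  exact (displacedCreationProd β).graph.smul_mem 𝒩⁻¹ ((displacedCreationProd β).mem_graph ⟨G, hG⟩)

lemma IsStellarDecomposition.isHusimiRoots {ψ : ModeSpace} {r : ℕ} {β : Fin r → ℂ} {G : ModeSpace}
    {𝒩 : ℂ} (h : IsStellarDecomposition ψ β G 𝒩) : IsHusimiRoots ψ β := fun z => by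
  have h0 : husimiMultiplicity (𝒩⁻¹ • G) z = 0 := by
    rw [husimiMultiplicity_eq_zero_iff, stellarFunction_smul]
    exact mul_ne_zero (inv_ne_zero h.const_ne_zero) (h.gaussian.stellarFunction_ne_zero _)
  rw [husimiMultiplicity_of_mem_graph_displacedCreationProd h.mem_graph, h0, add_zero]

lemma IsHusimiRoots.exists_equiv {ψ : ModeSpace} {s t : ℕ} {β : Fin s → ℂ} {γ : Fin t → ℂ}
    (hβ : IsHusimiRoots ψ β) (hγ : IsHusimiRoots ψ γ) :
    ∃ e : Fin s ≃ Fin t, ∀ n, β n = γ (e n) := by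
  have h : ∀ z, Nonempty ({n : Fin s // β n = z} ≃ {n : Fin t // γ n = z}) := fun z => by
    have : Nat.card {n : Fin s // β n = z} = Nat.card {n : Fin t // γ n = z} := by
      exact_mod_cast (hβ z).symm.trans (hγ z)
    exact Finite.card_eq.1 this
  exact ⟨Equiv.ofFiberEquiv fun z => (h z).some, fun n => (Equiv.ofFiberEquiv_map _ n).symm⟩

/-- Products of displaced creation operators that differ by a permutation of the factors agree,
and are injective. -/
lemma eq_of_mem_graph_displacedCreationProd {s t : ℕ} {β : Fin s → ℂ} {γ : Fin t → ℂ}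
    (e : Fin s ≃ Fin t) (he : ∀ n, β n = γ (e n)) {φ φ' χ : ModeSpace}
    (h : (φ, χ) ∈ (displacedCreationProd β).graph)
    (h' : (φ', χ) ∈ (displacedCreationProd γ).graph) : φ = φ' := by
  apply stellarFunction_injective
  have hdense : Dense (Set.range fun n => conj (β n))ᶜ :=
    (Set.finite_range _).countable.dense_compl ℝ
  refine Continuous.ext_on hdense (differentiable_stellarFunction φ).continuous
    (differentiable_stellarFunction φ').continuous fun α hα => ?_
  have h1 := stellarFunction_of_mem_graph_displacedCreationProd β h α
  rw [stellarFunction_of_mem_graph_displacedCreationProd γ h' α,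
    ← e.prod_comp fun n => α - conj (γ n)] at h1
  simp only [← he] at h1
  refine (mul_left_cancel₀ (Finset.prod_ne_zero_iff.2 fun n _ => ?_) h1).symm
  exact sub_ne_zero.2 fun hn => hα ⟨n, hn.symm⟩

lemma IsStellarDecomposition.unique {ψ : ModeSpace} {s t : ℕ} {β : Fin s → ℂ} {γ : Fin t → ℂ}
    {G G' : ModeSpace} {𝒩 𝒩' : ℂ} (h : IsStellarDecomposition ψ β G 𝒩)
    (h' : IsStellarDecomposition ψ γ G' 𝒩') :
    (∃ e : Fin s ≃ Fin t, ∀ n, β n = γ (e n)) ∧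
      ∃ u : ℂ, ‖u‖ = 1 ∧ G' = u • G ∧ 𝒩' = u * 𝒩 := by
  obtain ⟨e, he⟩ := h.isHusimiRoots.exists_equiv h'.isHusimiRoots
  have hG := eq_of_mem_graph_displacedCreationProd e he h.mem_graph h'.mem_graph
  have hG' : G' = (𝒩' / 𝒩) • G := by
    rw [div_eq_mul_inv, mul_smul, hG, smul_inv_smul₀ h'.const_ne_zero]
  refine ⟨⟨e, he⟩, 𝒩' / 𝒩, ?_, hG', (div_mul_cancel₀ _ h.const_ne_zero).symm⟩
  have hn := h'.gaussian.1
  rwa [hG', norm_smul, h.gaussian.1, mul_one] at hn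

end Stellar

theorem theorem2 (ψ : Stellar.ModeSpace) (hψ : ‖ψ‖ = 1) (r : ℕ)
    (hr : Stellar.stellarRank ψ = (r : ℕ∞)) :
    -- the Husimi function has exactly `r` roots, counted with multiplicity
    (∃ β : Fin r → ℂ, Stellar.IsHusimiRoots ψ β) ∧
    -- existence of the decomposition, for every listing of the roots
    (∀ β : Fin r → ℂ, Stellar.IsHusimiRoots ψ β →
      ∃ (G : Stellar.ModeSpace) (𝒩 : ℝ), 0 < 𝒩 ∧
        Stellar.IsStellarDecomposition ψ β G (𝒩 : ℂ)) ∧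
    -- uniqueness, up to reordering of the roots and a global phase of the Gaussian state
    (∀ (s t : ℕ) (β : Fin s → ℂ) (γ : Fin t → ℂ) (G G' : Stellar.ModeSpace) (𝒩 𝒩' : ℂ),
      Stellar.IsStellarDecomposition ψ β G 𝒩 → Stellar.IsStellarDecomposition ψ γ G' 𝒩' →
        (∃ e : Fin s ≃ Fin t, ∀ n, β n = γ (e n)) ∧
        ∃ u : ℂ, ‖u‖ = 1 ∧ G' = u • G ∧ 𝒩' = u * 𝒩) := by
  exact ⟨Stellar.exists_isHusimiRoots hr, fun β hβ => hβ.exists_isStellarDecomposition,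
    fun s t β γ G G' 𝒩 𝒩' h h' => h.unique h'⟩
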